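/- Let $1<B<2$ and $0<\kappa<\min(B^2/4,\,1/2)$. **Model.** For $i,j\in\mathbb N=\{1,2,\dots\}$ let $d(i,j)$ be the least $p\ge 0$ such that $i,j$ belong to the same block $\{(k-1)2^p+1,\dots,k2^p\}$ for some $k$. Let $\omega=(\omega_i)_{i\in\mathbb N}$ be a centered Gaussian sequence with $\mathbb E[\omega_i\omega_j]=\kappa^{d(i,j)}$. For $\beta\ge 0$, $h\in\mathbb R$ set $Z_0^{(i)}=e^{\beta\omega_i+h}$ and $Z_{n+1}^{(i)}=\big(Z_n^{(2i-1)}Z_n^{(2i)}+B-1\big)/B$. The annealed free energy is $\mathtt F^{a}(\beta,h)=\lim_{n\to\infty}2^{-n}\log\mathbb E[Z_n^{(1)}]$, and the annealed critical point is $h_c^a=h_c^a(\beta)=\sup\{h:\mathtt F^a(\beta,h)=0\}$. Let $\mathbf E_n$ be the expectation for $n$ generations of a Galton–Watson tree started from one individual, with offspring number $0$ with probability $(B-1)/B$ and $2$ with probability $1/B$. Viewing it as a random subtree of the full binary tree, let $\delta_i\in\{0,1\}$, $1\le i\le 2^n$, indicate whether the individual $i$ is present at generation $n$, let $S_n=\sum_{i=1}^{2^n}\delta_i$,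 and let $$H^{a}_{n,h}=h\,S_n+\frac{\beta^2}{2}\sum_{i,j=1}^{2^n}\kappa^{d(i,j)}\delta_i\delta_j .$$ The pure free energy is $\mathtt F(h)=\lim_{n\to\infty}2^{-n}\log\mathbf E_n[e^{hS_n}]$. Finally let $\nu=\log 2/\log(2/B)$. **Theorem.** The limit $\mathtt F(h)$ exists for every $h\in\mathbb R$, and there are constants $c,c'>0$ with $c\,u^\nu\le\mathtt F(u)\le c'\,u^\nu$ for all $u\in[0,1]$ (the pure critical exponent is $\nu$). Moreover there exist $\beta_0>0$ and $c_1,c_2>0$, depending only on $B$ and $\kappa$, such that for every $\beta\in[0,\beta_0]$: 1. the limit $\mathtt F^a(\beta,h)$ exists for every $h\in\mathbb R$, with $\mathtt F^a(\beta,h)=0$ for $h\le h_c^a$ and $\mathtt F^a(\beta,h)>0$ for $h>h_c^a$; 2. for every $u\in[0,1]$ and every $n\ge 0$, $$-c_2\beta^2\Big(\frac{4\kappa}{B^2}\Big)^n+\mathbf E_n\big[\exp(e^{-c_1\beta^2}uS_n)\big]\le\mathbf E_n\big[\exp(uS_n)\,e^{H^a_{n,h_c^a}}\big]\le\mathbf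 E_n\big[\exp(e^{c_1\beta^2}uS_n)\big];$$ 3. for every $u\in[0,1]$, $$\mathtt F(e^{-c_1\beta^2}u)\le\mathtt F^a(\beta,h_c^a+u)\le\mathtt F(e^{c_1\beta^2}u);$$ 4. there are constants $C,C'>0$ with $C\,u^\nu\le\mathtt F^a(\beta,h_c^a+u)\le C'\,u^\nu$ for all $u\in[0,1]$, that is, the annealed critical exponent equals the pure exponent $\nu$. -/

import Mathlib

open MeasureTheory ProbabilityTheory Filter Topology Finset

noncomputable section

namespace HierPinning

/-! Leaves of the binary tree are numbered from `0`, so that the `k`-th block of size `2 ^ p`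
(`k = 0, 1, …`) is `{k * 2 ^ p, …, (k + 1) * 2 ^ p - 1} = {i | i / 2 ^ p = k}`. -/

/-- The hierarchical (tree) distance: the least `p` such that `i` and `j` lie in the same block of
size `2 ^ p`. -/
def hierDist (i j : ℕ) : ℕ := sInf {p : ℕ | i / 2 ^ p = j / 2 ^ p}

/-- `ω` is a version of the disorder: a centered Gaussian sequence with
`E[ω_i ω_j] = κ ^ d(i,j)`. -/
structure IsHierarchicalDisorder {Ω : Type*} [MeasurableSpace Ω] (κ : ℝ) (ω : ℕ → Ω → ℝ)
    (P : Measure Ω) : Prop where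
  gaussian : IsGaussianProcess ω P
  centered : ∀ i, ∫ x, ω i x ∂P = 0
  covariance : ∀ i j, ∫ x, ω i x * ω j x ∂P = κ ^ hierDist i j

/-- The partition function `Z_n^{(i)}` on the `i`-th block of size `2 ^ n`, in the environment
`w`. -/
def blockPartition (B β h : ℝ) (w : ℕ → ℝ) : ℕ → ℕ → ℝ
  | 0, i => Real.exp (β * w i + h)
  | n + 1, i =>
      (blockPartition B β h w n (2 * i) * blockPartition B β h w n (2 * i + 1) + B - 1) / B

/-- The annealed partition function `E[Z_n]`. -/
def annealedPartition {Ω : Type*} [MeasurableSpace Ω] (P : Measure Ω) (ω : ℕ → Ω → ℝ)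
    (B β h : ℝ) (n : ℕ) : ℝ :=
  ∫ x, blockPartition B β h (fun i => ω i x) n 0 ∂P

/-- The annealed free energy at size `2 ^ n`. -/
def annealedFreeEnergyAt {Ω : Type*} [MeasurableSpace Ω] (P : Measure Ω) (ω : ℕ → Ω → ℝ)
    (B β h : ℝ) (n : ℕ) : ℝ :=
  1 / 2 ^ n * Real.log (annealedPartition P ω B β h n)

/-- The annealed free energy `F^a(β, h)`. -/
def annealedFreeEnergy {Ω : Type*} [MeasurableSpace Ω] (P : Measure Ω) (ω : ℕ → Ω → ℝ)
    (B β h : ℝ) : ℝ :=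
  limUnder atTop (annealedFreeEnergyAt P ω B β h)

/-- The annealed critical point `h_c^a(β)`. -/
def annealedCriticalPoint {Ω : Type*} [MeasurableSpace Ω] (P : Measure Ω) (ω : ℕ → Ω → ℝ)
    (B β : ℝ) : ℝ :=
  sSup {h : ℝ | annealedFreeEnergy P ω B β h = 0}

/-- Binary genealogical trees up to generation `n`: at each generation before the `n`-th an
individual has either no child (`none`) or two children (`some (l, r)`). -/
def GWTree : ℕ → Type
  | 0 => Unit
  | n + 1 => Option (GWTree n × GWTree n)

instance instFintypeGWTree : (n : ℕ) → Fintype (GWTree n)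
  | 0 => inferInstanceAs (Fintype Unit)
  | n + 1 =>
      haveI := instFintypeGWTree n
      inferInstanceAs (Fintype (Option (GWTree n × GWTree n)))

/-- The Galton–Watson law with offspring number `0` with probability `(B - 1) / B` and `2` with
probability `1 / B`. -/
def gwProb (B : ℝ) : (n : ℕ) → GWTree n → ℝ
  | 0, _ => 1
  | _ + 1, none => (B - 1) / B
  | n + 1, some (l, r) => 1 / B * (gwProb B n l * gwProb B n r)

/-- The expectation `E_n` under the Galton–Watson law. -/
def gwExp (B : ℝ) (n : ℕ) (f : GWTree n → ℝ) : ℝ := ∑ T, gwProb B n T * f T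

/-- The set `R_n ⊆ {0, …, 2 ^ n - 1}` of individuals present at generation `n`. -/
def present : (n : ℕ) → GWTree n → Finset ℕ
  | 0, _ => {0}
  | _ + 1, none => ∅
  | n + 1, some (l, r) => present n l ∪ (present n r).map (addLeftEmbedding (2 ^ n))

/-- `δ_i`, the indicator that the individual `i` is present at generation `n`. -/
def contact {n : ℕ} (T : GWTree n) (i : ℕ) : ℝ := if i ∈ present n T then 1 else 0

/-- The number of contacts `S_n`. -/
def contactSum {n : ℕ} (T : GWTree n) : ℝ := ∑ k ∈ range (2 ^ n), contact T k

/-- The annealed Hamiltonian `H_{n,h}^a`. -/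
def annealedHamiltonian (κ β h : ℝ) {n : ℕ} (T : GWTree n) : ℝ :=
  h * ∑ k ∈ range (2 ^ n), contact T k +
    β ^ 2 / 2 * ∑ i ∈ range (2 ^ n), ∑ j ∈ range (2 ^ n),
      κ ^ hierDist i j * contact T i * contact T j

/-- The free energy at size `2 ^ n` of the pure model. -/
def pureFreeEnergyAt (B h : ℝ) (n : ℕ) : ℝ :=
  1 / 2 ^ n * Real.log (gwExp B n fun T => Real.exp (h * contactSum T))

/-- The free energy `F(h)` of the pure model. -/
def pureFreeEnergy (B h : ℝ) : ℝ := limUnder atTop (pureFreeEnergyAt B h)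

/-- `f` (a free energy, as a function of the distance `u ≥ 0` to the critical point) has critical
exponent `ν`: it is of exact order `u ^ ν`. -/
def HasCriticalExponent (f : ℝ → ℝ) (ν : ℝ) : Prop :=
  ∃ c > 0, ∃ c' > 0, ∀ u ∈ Set.Icc (0 : ℝ) 1, c * u ^ ν ≤ f u ∧ f u ≤ c' * u ^ ν

/-! ### The disorder exists

A sequence as in `IsHierarchicalDisorder` is exhibited as finite linear combinations of independent
standard Gaussian variables. The facts below only serve this purpose. -/

/-- Coordinatewise scalar product of finitely supported families. -/
def ip : ((ℕ ⊕ ℕ × ℕ) →₀ ℝ) →ₗ[ℝ] ((ℕ ⊕ ℕ × ℕ) →₀ ℝ) →ₗ[ℝ] ℝ :=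
  Finsupp.linearCombination ℝ fun a => Finsupp.lapply a

lemma ip_single (a b : ℕ ⊕ ℕ × ℕ) (x y : ℝ) :
    ip (Finsupp.single a x) (Finsupp.single b y) = if a = b then x * y else 0 := by
  classical
  simp [ip, Finsupp.linearCombination_single, Finsupp.single_apply, eq_comm]

lemma ip_comm (f g : (ℕ ⊕ ℕ × ℕ) →₀ ℝ) : ip f g = ip g f := by
  induction f using Finsupp.induction_linear with
  | zero => simp
  | add f₁ f₂ h₁ h₂ => simp [h₁, h₂]
  | single a x =>
    induction g using Finsupp.induction_linear with
    | zero => simp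
    | add f₁ f₂ h₁ h₂ => simp [h₁, h₂]
    | single b y => simp only [ip_single, eq_comm, mul_comm]

/-- Coefficients of a Gaussian sequence with covariances `κ ^ max p q`. -/
def spine (κ : ℝ) : ℕ → ((ℕ ⊕ ℕ × ℕ) →₀ ℝ)
  | 0 => Finsupp.single (Sum.inl 0) 1
  | p + 1 => κ • spine κ p + Finsupp.single (Sum.inl (p + 1)) √(κ ^ (p + 1) * (1 - κ))

/-- Coefficients of the part of `ω_i` due to its blocks of size less than `2 ^ m`. -/
def branch (κ : ℝ) (i : ℕ) (m : ℕ) : (ℕ ⊕ ℕ × ℕ) →₀ ℝ :=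
  ∑ q ∈ range m, Finsupp.single (Sum.inr (q, i / 2 ^ q)) √(κ ^ q - κ ^ (q + 1))

/-- Coefficients of `ω_i`. -/
def leafVec (κ : ℝ) (i : ℕ) : (ℕ ⊕ ℕ × ℕ) →₀ ℝ :=
  spine κ (hierDist 0 i) + branch κ i (hierDist 0 i)

lemma ip_spine_inl (κ : ℝ) (p m : ℕ) (h : p < m) (x : ℝ) :
    ip (spine κ p) (Finsupp.single (Sum.inl m) x) = 0 := by
  induction p with
  | zero => simp [spine, ip_single]; omega
  | succ p ih => simp [spine, ip_single, ih (by omega)]; omega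

lemma ip_spine_inr (κ : ℝ) (p : ℕ) (a : ℕ × ℕ) (x : ℝ) :
    ip (spine κ p) (Finsupp.single (Sum.inr a) x) = 0 := by
  induction p with
  | zero => simp [spine, ip_single]
  | succ p ih => simp [spine, ip_single, ih]

lemma ip_spine_self {κ : ℝ} (h0 : 0 < κ) (h1 : κ < 1) (p : ℕ) :
    ip (spine κ p) (spine κ p) = κ ^ p := by
  induction p with
  | zero => simp [spine, ip_single]
  | succ p ih =>
    have h3 := ip_spine_inl κ p (p + 1) (by omega) √(κ ^ (p + 1) * (1 - κ))
    have h2 : √(κ ^ (p + 1) * (1 - κ)) * √(κ ^ (p + 1) * (1 - κ)) = κ ^ (p + 1) * (1 - κ) :=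
      Real.mul_self_sqrt (mul_nonneg (by positivity) (by linarith))
    have h4 := h3
    rw [ip_comm] at h4
    simp only [spine, map_add, map_smul, LinearMap.add_apply, LinearMap.smul_apply, ih, h3, h4,
      ip_single, if_true, smul_eq_mul]
    rw [h2]; ring

lemma ip_spine_add {κ : ℝ} (h0 : 0 < κ) (h1 : κ < 1) (p k : ℕ) :
    ip (spine κ p) (spine κ (p + k)) = κ ^ (p + k) := by
  induction k with
  | zero => exact ip_spine_self h0 h1 p
  | succ k ih =>
    rw [← add_assoc]
    simp only [spine, map_add, map_smul, ih, smul_eq_mul]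
    rw [ip_spine_inl κ p (p + k + 1) (by omega)]; ring

lemma ip_spine {κ : ℝ} (h0 : 0 < κ) (h1 : κ < 1) (p q : ℕ) :
    ip (spine κ p) (spine κ q) = κ ^ max p q := by
  rcases le_total p q with h | h
  · obtain ⟨k, rfl⟩ := Nat.exists_eq_add_of_le h
    rw [ip_spine_add h0 h1, max_eq_right h]
  · obtain ⟨k, rfl⟩ := Nat.exists_eq_add_of_le h
    rw [ip_comm, ip_spine_add h0 h1, max_eq_left h]

lemma div_eq_iff_hierDist (i j p : ℕ) : i / 2 ^ p = j / 2 ^ p ↔ hierDist i j ≤ p := by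
  constructor
  · intro h; exact Nat.sInf_le h
  · intro h
    have hne : {p : ℕ | i / 2 ^ p = j / 2 ^ p}.Nonempty := by
      refine ⟨i + j, ?_⟩
      have := (i + j).lt_two_pow_self
      simp [Nat.div_eq_of_lt (show i < 2 ^ (i + j) by omega),
        Nat.div_eq_of_lt (show j < 2 ^ (i + j) by omega)]
    have h2 : i / 2 ^ hierDist i j = j / 2 ^ hierDist i j := Nat.sInf_mem hne
    obtain ⟨k, rfl⟩ := Nat.exists_eq_add_of_le h
    rw [pow_add, ← Nat.div_div_eq_div_mul, ← Nat.div_div_eq_div_mul, h2]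

lemma ip_branch {κ : ℝ} (h0 : 0 < κ) (h1 : κ < 1) (i j a b : ℕ) :
    ip (branch κ i a) (branch κ j b)
      = ∑ q ∈ (range (min a b)).filter (hierDist i j ≤ ·), (κ ^ q - κ ^ (q + 1)) := by
  have hs (q : ℕ) : √(κ ^ q - κ ^ (q + 1)) * √(κ ^ q - κ ^ (q + 1)) = κ ^ q - κ ^ (q + 1) := by
    apply Real.mul_self_sqrt
    have : 0 ≤ κ ^ q * (1 - κ) := mul_nonneg (by positivity) (by linarith)
    rw [pow_succ]; linarith
  simp only [branch, map_sum, LinearMap.sum_apply, ip_single, Sum.inr.injEq, Prod.mk.injEq]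
  have key (x : ℕ) : (∑ y ∈ range a, if y = x ∧ i / 2 ^ y = j / 2 ^ x then
      √(κ ^ y - κ ^ (y + 1)) * √(κ ^ x - κ ^ (x + 1)) else 0)
      = if x < a ∧ hierDist i j ≤ x then κ ^ x - κ ^ (x + 1) else 0 := by
    simp only [ite_and, sum_ite_eq', mem_range, div_eq_iff_hierDist, hs]
  simp only [key]
  rw [← sum_filter]
  congr 1
  ext x; simp; omega

lemma sum_filter_telescope {κ : ℝ} (d m : ℕ) :
    ∑ q ∈ (range m).filter (d ≤ ·), (κ ^ q - κ ^ (q + 1)) = κ ^ min d m - κ ^ m := by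
  induction m with
  | zero => simp
  | succ m ih =>
    rw [range_add_one, filter_insert]
    split_ifs with h
    · rw [sum_insert (by simp), ih, min_eq_left h, min_eq_left (by omega)]; ring
    · have : filter (fun q => d ≤ q) (range m) = ∅ := by ext; simp; omega
      rw [this, min_eq_right (by omega)]; simp

lemma ip_leafVec {κ : ℝ} (h0 : 0 < κ) (h1 : κ < 1) (i j : ℕ) :
    ip (leafVec κ i) (leafVec κ j) = κ ^ hierDist i j := by
  have h2 (p i m : ℕ) : ip (spine κ p) (branch κ i m) = 0 := by
    simp [branch, ip_spine_inr]
  have h3 (p i m : ℕ) : ip (branch κ i m) (spine κ p) = 0 := by rw [ip_comm, h2]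
  simp only [leafVec, map_add, LinearMap.add_apply, h2, h3, ip_spine h0 h1, ip_branch h0 h1,
    sum_filter_telescope, add_zero, zero_add]
  have e1 := fun p => div_eq_iff_hierDist 0 i p
  have e2 := fun p => div_eq_iff_hierDist 0 j p
  have e3 := fun p => div_eq_iff_hierDist i j p
  set a := hierDist 0 i
  set b := hierDist 0 j
  set d := hierDist i j
  have f1 : d ≤ max a b := (e3 _).1 (((e1 _).2 (le_max_left ..)).symm.trans
    ((e2 _).2 (le_max_right ..)))
  have f2 : a ≤ max b d := (e1 _).1 (((e2 _).2 (le_max_left ..)).trans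
    ((e3 _).2 (le_max_right ..)).symm)
  have f3 : b ≤ max a d := (e2 _).1 (((e1 _).2 (le_max_left ..)).trans
    ((e3 _).2 (le_max_right ..)))
  rcases lt_trichotomy a b with h | h | h
  · rw [show max a b = d by omega, show min d (min a b) = min a b by omega]; ring
  · rw [h, max_self, min_self, show min d b = d by omega]; ring
  · rw [show max a b = d by omega, show min d (min a b) = min a b by omega]; ring

/-- The hierarchically correlated Gaussian disorder exists. -/
theorem exists_isHierarchicalDisorder {κ : ℝ} (h0 : 0 < κ) (h1 : κ < 1) :
    ∃ (Ω : Type) (_ : MeasurableSpace Ω) (P : Measure Ω) (ω : ℕ → Ω → ℝ),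
      IsHierarchicalDisorder κ ω P := by
  obtain ⟨Ω, _, P, ξ, hm, hl, hi, hP⟩ := exists_iid (ℕ ⊕ ℕ × ℕ) (gaussianReal 0 1)
  have hG : IsGaussianProcess ξ P :=
    ⟨fun I => (hi.precomp (g := ((↑) : I → ℕ ⊕ ℕ × ℕ)) Subtype.val_injective).hasGaussianLaw
      (fun i => ⟨by
        change IsGaussian (P.map (ξ i.1))
        rw [(hl i.1).map_eq]; infer_instance⟩)⟩
  have hL2 (a) : MemLp (ξ a) 2 P := (hG.hasGaussianLaw_eval a).memLp_two
  have hmean (a) : ∫ x, ξ a x ∂P = 0 := by rw [(hl a).integral_eq, integral_id_gaussianReal]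
  have hcov (a b) : ∫ x, ξ a x * ξ b x ∂P = if a = b then 1 else 0 := by
    have hc : cov[ξ a, ξ b; P] = ∫ x, ξ a x * ξ b x ∂P := by
      rw [covariance_eq_sub (hL2 a) (hL2 b), hmean a]; simp
    rw [← hc]
    split_ifs with h
    · subst h
      rw [covariance_self (hm a).aemeasurable, (hl a).variance_eq, variance_id_gaussianReal]; simp
    · exact (hi.indepFun h).covariance_eq_zero (hL2 a) (hL2 b)
  let L (c : (ℕ ⊕ ℕ × ℕ) →₀ ℝ) (x : Ω) : ℝ := ∑ a ∈ c.support, c a * ξ a x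
  have hLint (c) : ∫ x, L c x ∂P = 0 := by
    simp only [L]
    rw [integral_finsetSum _ fun a _ => ((hL2 a).integrable (by norm_num)).const_mul _]
    simp [integral_const_mul, hmean]
  have hLip (c d) : ∫ x, L c x * L d x ∂P = ip c d := by
    simp only [L, sum_mul_sum]
    have hint (a b) : Integrable (fun x => c a * ξ a x * (d b * ξ b x)) P := by
      have := ((hL2 a).integrable_mul (hL2 b)).const_mul (c a * d b)
      refine this.congr (ae_of_all _ fun x => ?_)
      simp only [Pi.mul_apply]; ring
    rw [integral_finsetSum _ fun a _ => integrable_finsetSum _ fun b _ => hint a b]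
    have : ip c d = ∑ a ∈ c.support, c a * d a := by
      simp [ip, Finsupp.linearCombination_apply, Finsupp.sum, LinearMap.sum_apply]
    rw [this]
    refine sum_congr rfl fun a _ => ?_
    rw [integral_finsetSum _ fun b _ => hint a b]
    have hab (b) : ∫ x, c a * ξ a x * (d b * ξ b x) ∂P = c a * d b * if a = b then 1 else 0 := by
      rw [← hcov, ← integral_const_mul]; congr with x; ring
    simp only [hab, mul_ite, mul_one, mul_zero, sum_ite_eq]
    split_ifs with h
    · rfl
    · rw [Finsupp.notMem_support_iff.1 h, mul_zero]
  refine ⟨Ω, _, P, fun i => L (leafVec κ i), ?_, fun i => hLint _, fun i j => ?_⟩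
  · refine hG.of_isGaussianProcess fun i => ⟨(leafVec κ i).support,
      ∑ a, (leafVec κ i a.1) • ContinuousLinearMap.proj a, fun x => ?_⟩
    simp only [L, _root_.sum_apply]
    rw [← sum_coe_sort]
    rfl
  · rw [hLip, ip_leafVec h0 h1]

end HierPinning

end

open HierPinning

namespace HierPinning

/-! ### Recursions on trees -/

/-! Integrating out the disorder turns `E[Z_n]` into `treePart`, the Galton–Watson average of `exp
H^a`: a sum of Gaussians over the surviving leaves has as variance the double sum of `κ ^ d(i,j)`.
The Hamiltonian splits over the two subtrees up to an interaction `β² κ^(n+1) S_l S_r`. As `κ <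
1/2`, the quadratic part is at most a constant times `S_n`, and `Z_n / B` is supermultiplicative
along the recursion, so the free energy exists.

The heart is `exists_critical_field`: for small `β` there is one field `h` at which, for every `n`
and every `k ≥ 1`, the annealed moment `E_n[S^k e^H]` equals the pure moment `E_n[S^k]` up to a
factor `e^(±tk)` with `t = c₁ β²`, while the total mass stays in `[1 - c₂ β² (4κ/B²)^n, 1]`. A
factor `e^(±tk)` on the coefficient of `u^k` is a rescaling of `u` by `e^(±t)`, so summing the
exponential series compares the generating functions and, in the limit, the free energies.
Positivity of the pure free energy then identifies `h` with `h_c^a`.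

The moments are controlled by induction on `n`, at the field `h_n` of total mass one. Without
interaction, normalized annealed moments obey the same binomial recursion as pure ones. The
interaction is expanded in powers of `S_l S_r`; the ratio bound `M_(k+1) ≤ A g^n √(k+1) M_k`, with
`g = max (2/B) √2`, makes that expansion a negative binomial series (`annMom_succ_le`), at the cost
of a factor `exp(O(β² ρ^n) k)` with `ρ = κ g²`. The hypotheses on `κ` say exactly that `ρ < 1`, so
the errors are summable. Passing from `h_n` to `h_(n+1)` costs an error of the same kind
(`field_sub_le`, `MomComparable.sub`).

The ratio bound follows from log-convexity of the moments and a doubling estimate for the pure model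
(`pureMom_two_mul_le`). The pure exponent comes from the scale `j` with `(B/2)^j` of order `u`,
where `E_j[e^(uS)]` is of order one, since `(B/2)^ν = 1/2`. -/

/-- The tree whose root has no child. -/
def GWTree.dead (n : ℕ) : GWTree (n + 1) := (none : Option (GWTree n × GWTree n))

/-- The tree whose root has two children. -/
def GWTree.node {n : ℕ} (l r : GWTree n) : GWTree (n + 1) := some (l, r)

lemma GWTree.cases {n : ℕ} (T : GWTree (n + 1)) :
    T = GWTree.dead n ∨ ∃ l r, T = GWTree.node l r := by
  rcases (T : Option (GWTree n × GWTree n)) with _ | ⟨l, r⟩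
  · exact Or.inl rfl
  · exact Or.inr ⟨l, r, rfl⟩

/-- The tree of height `0`. -/
def GWTree.leaf : GWTree 0 := ()

lemma gwExp_zero (B : ℝ) (f : GWTree 0 → ℝ) : gwExp B 0 f = f GWTree.leaf := by
  change ∑ T : Unit, 1 * f T = _
  rw [Fintype.sum_unique, one_mul]
  rfl

lemma gwExp_succ (B : ℝ) (n : ℕ) (f : GWTree (n + 1) → ℝ) :
    gwExp B (n + 1) f = (B - 1) / B * f (GWTree.dead n) +
      1 / B * gwExp B n fun l => gwExp B n fun r => f (GWTree.node l r) := by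
  change ∑ T : Option (GWTree n × GWTree n), gwProb B (n + 1) T * f T = _
  rw [Fintype.sum_option, Fintype.sum_prod_type]
  simp only [gwExp, mul_sum]
  congr 1
  refine sum_congr rfl fun l _ => sum_congr rfl fun r _ => ?_
  change 1 / B * (gwProb B n l * gwProb B n r) * f (GWTree.node l r) = _
  ring

lemma gwProb_nonneg {B : ℝ} (hB : 1 ≤ B) : ∀ (n : ℕ) (T : GWTree n), 0 ≤ gwProb B n T
  | 0, _ => zero_le_one
  | n + 1, T => by
    rcases T.cases with rfl | ⟨l, r, rfl⟩
    · change 0 ≤ (B - 1) / B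
      exact div_nonneg (by linarith) (by linarith)
    · change 0 ≤ 1 / B * (gwProb B n l * gwProb B n r)
      have := gwProb_nonneg hB n l
      have := gwProb_nonneg hB n r
      positivity

lemma gwExp_const {B : ℝ} (hB : 1 ≤ B) (n : ℕ) (c : ℝ) : gwExp B n (fun _ => c) = c := by
  induction n with
  | zero => rw [gwExp_zero]
  | succ n ih => rw [gwExp_succ, ih, ih]; field_simp; ring

/-! ### Linearity and positivity of the Galton–Watson expectation. -/

section linear
variable {B : ℝ} {n : ℕ}

lemma gwExp_mul_left (c : ℝ) (f : GWTree n → ℝ) :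
    gwExp B n (fun T => c * f T) = c * gwExp B n f := by
  simp only [gwExp, mul_sum]; exact sum_congr rfl fun _ _ => by ring

lemma gwExp_mul_right (c : ℝ) (f : GWTree n → ℝ) :
    gwExp B n (fun T => f T * c) = gwExp B n f * c := by
  simp only [gwExp, sum_mul]; exact sum_congr rfl fun _ _ => by ring

lemma gwExp_add (f g : GWTree n → ℝ) :
    gwExp B n (fun T => f T + g T) = gwExp B n f + gwExp B n g := by
  simp only [gwExp, mul_add, sum_add_distrib]

lemma gwExp_sub (f g : GWTree n → ℝ) :
    gwExp B n (fun T => f T - g T) = gwExp B n f - gwExp B n g := by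
  simp only [gwExp, mul_sub, sum_sub_distrib]

lemma gwExp_sum {ι : Type*} (s : Finset ι) (f : ι → GWTree n → ℝ) :
    gwExp B n (fun T => ∑ i ∈ s, f i T) = ∑ i ∈ s, gwExp B n (f i) := by
  simp only [gwExp, mul_sum]; exact sum_comm

lemma hasSum_gwExp {f : ℕ → GWTree n → ℝ} {g : GWTree n → ℝ}
    (h : ∀ T, HasSum (fun k => f k T) (g T)) :
    HasSum (fun k => gwExp B n (f k)) (gwExp B n g) :=
  hasSum_sum fun T _ => (h T).mul_left _

lemma gwExp_mono (hB : 1 ≤ B) {f g : GWTree n → ℝ} (h : ∀ T, f T ≤ g T) :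
    gwExp B n f ≤ gwExp B n g :=
  sum_le_sum fun T _ => mul_le_mul_of_nonneg_left (h T) (gwProb_nonneg hB n T)

lemma gwExp_nonneg (hB : 1 ≤ B) {f : GWTree n → ℝ} (h : ∀ T, 0 ≤ f T) : 0 ≤ gwExp B n f :=
  sum_nonneg fun T _ => mul_nonneg (gwProb_nonneg hB n T) (h T)

/-- A product of functions of the two subtrees. -/
lemma gwExp_gwExp_mul (f g : GWTree n → ℝ) :
    (gwExp B n fun l => gwExp B n fun r => f l * g r) = gwExp B n f * gwExp B n g := by
  simp only [gwExp_mul_left, gwExp_mul_right]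

/-- Individual trees may have probability zero when `B = 1`, so positivity is obtained from a
positive lower bound of `f` on the finite set of trees. -/
lemma gwExp_pos (hB : 1 ≤ B) {f : GWTree n → ℝ} (h : ∀ T, 0 < f T) : 0 < gwExp B n f := by
  obtain ⟨c, hc, hcf⟩ : ∃ c > 0, ∀ T, c ≤ f T := by
    rcases isEmpty_or_nonempty (GWTree n) with he | he
    · exact ⟨1, one_pos, fun T => he.elim T⟩
    · obtain ⟨T₀, h₀⟩ := Finite.exists_min f
      exact ⟨f T₀, h T₀, h₀⟩
  calc 0 < c := hc
    _ = gwExp B n fun _ => c := (gwExp_const hB n c).symm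
    _ ≤ _ := gwExp_mono hB hcf

end linear

/-! ### Contacts, the hierarchical distance and the Hamiltonian under splitting at the root. -/

lemma present_dead (n : ℕ) : present (n + 1) (GWTree.dead n) = ∅ := rfl

lemma present_node {n : ℕ} (l r : GWTree n) : present (n + 1) (GWTree.node l r) =
    present n l ∪ (present n r).map (addLeftEmbedding (2 ^ n)) := rfl

lemma lt_of_mem_present : ∀ {n : ℕ} (T : GWTree n) {i : ℕ}, i ∈ present n T → i < 2 ^ n
  | 0, T, i, h => by
    have : i ∈ ({0} : Finset ℕ) := h
    simp_all
  | n + 1, T, i, h => by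
    rcases T.cases with rfl | ⟨l, r, rfl⟩
    · simp [present_dead] at h
    · rw [present_node, mem_union, Finset.mem_map] at h
      rw [pow_succ]
      rcases h with h | ⟨j, hj, rfl⟩
      · have := lt_of_mem_present l h; omega
      · have := lt_of_mem_present r hj
        simp only [addLeftEmbedding_apply]; omega

lemma disjoint_present {n : ℕ} (l r : GWTree n) :
    Disjoint (present n l) ((present n r).map (addLeftEmbedding (2 ^ n))) := by
  rw [disjoint_left]
  intro i hi hj
  obtain ⟨j, _, rfl⟩ := Finset.mem_map.1 hj
  have := lt_of_mem_present l hi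
  simp only [addLeftEmbedding_apply] at this; omega

lemma sum_contact_mul {n : ℕ} (T : GWTree n) (f : ℕ → ℝ) :
    ∑ k ∈ range (2 ^ n), f k * contact T k = ∑ k ∈ present n T, f k := by
  simp only [contact, mul_ite, mul_one, mul_zero]
  rw [← sum_filter]
  congr 1
  ext i
  simp only [mem_filter, mem_range, and_iff_right_iff_imp]
  exact lt_of_mem_present T

lemma sum_present_node {n : ℕ} (l r : GWTree n) (f : ℕ → ℝ) :
    ∑ k ∈ present (n + 1) (GWTree.node l r), f k =
      ∑ k ∈ present n l, f k + ∑ k ∈ present n r, f (2 ^ n + k) := by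
  rw [present_node, sum_union (disjoint_present l r), sum_map]; rfl

lemma contactSum_eq {n : ℕ} (T : GWTree n) : contactSum T = ∑ _k ∈ present n T, (1 : ℝ) := by
  rw [← sum_contact_mul]; simp [contactSum]

lemma contactSum_zero (T : GWTree 0) : contactSum T = 1 := by
  rw [contactSum_eq]
  change ∑ _k ∈ ({0} : Finset ℕ), (1 : ℝ) = 1
  simp

lemma contactSum_dead (n : ℕ) : contactSum (GWTree.dead n) = 0 := by
  rw [contactSum_eq, present_dead, sum_empty]

lemma contactSum_node {n : ℕ} (l r : GWTree n) :
    contactSum (GWTree.node l r) = contactSum l + contactSum r := by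
  simp only [contactSum_eq, sum_present_node]

lemma contactSum_nonneg {n : ℕ} (T : GWTree n) : 0 ≤ contactSum T := by
  rw [contactSum_eq]; exact sum_nonneg fun _ _ => zero_le_one

lemma contactSum_le : ∀ {n : ℕ} (T : GWTree n), contactSum T ≤ 2 ^ n
  | 0, T => by rw [contactSum_zero]; simp
  | n + 1, T => by
    rcases T.cases with rfl | ⟨l, r, rfl⟩
    · rw [contactSum_dead]; positivity
    · rw [contactSum_node, pow_succ]
      have := contactSum_le l
      have := contactSum_le r
      linarith

/-- The quadratic part of the annealed Hamiltonian. -/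
noncomputable def corrSum (κ : ℝ) {n : ℕ} (T : GWTree n) : ℝ :=
  ∑ i ∈ present n T, ∑ j ∈ present n T, κ ^ hierDist i j

lemma hierDist_comm (i j : ℕ) : hierDist i j = hierDist j i := by
  simp only [hierDist, eq_comm]

lemma hierDist_eq_of_forall {i j i' j' : ℕ}
    (h : ∀ p : ℕ, i / 2 ^ p = j / 2 ^ p ↔ i' / 2 ^ p = j' / 2 ^ p) :
    hierDist i j = hierDist i' j' := by
  simp only [hierDist, h]

lemma hierDist_self (i : ℕ) : hierDist i i = 0 :=
  Nat.le_zero.1 ((div_eq_iff_hierDist i i 0).1 rfl)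

/-- The shift `2 ^ n` is a multiple of the block size for `p ≤ n`; for `p > n` all four leaves lie
in block `0`. -/
lemma hierDist_shift {n i j : ℕ} (hi : i < 2 ^ n) (hj : j < 2 ^ n) :
    hierDist (2 ^ n + i) (2 ^ n + j) = hierDist i j := by
  refine hierDist_eq_of_forall fun p => ?_
  rcases le_or_gt p n with h | h
  · obtain ⟨k, rfl⟩ := Nat.exists_eq_add_of_le h
    rw [pow_add, Nat.mul_add_div (by positivity), Nat.mul_add_div (by positivity)]
    simp
  · have : 2 ^ (n + 1) ≤ 2 ^ p := Nat.pow_le_pow_right (by norm_num) h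
    rw [pow_succ] at this
    rw [Nat.div_eq_of_lt (by omega), Nat.div_eq_of_lt (by omega), Nat.div_eq_of_lt (by omega),
      Nat.div_eq_of_lt (by omega)]

lemma hierDist_cross {n i j : ℕ} (hi : i < 2 ^ n) (hj : j < 2 ^ n) :
    hierDist i (2 ^ n + j) = n + 1 := by
  apply le_antisymm
  · rw [← div_eq_iff_hierDist, Nat.div_eq_of_lt (by rw [pow_succ]; omega),
      Nat.div_eq_of_lt (by rw [pow_succ]; omega)]
  · by_contra! h
    have h2 := (div_eq_iff_hierDist i (2 ^ n + j) n).2 (by omega)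
    rw [Nat.div_eq_of_lt hi, Nat.add_div_left _ (by positivity)] at h2
    exact absurd h2 (Nat.succ_ne_zero _).symm

lemma corrSum_zero (κ : ℝ) (T : GWTree 0) : corrSum κ T = 1 := by
  change ∑ i ∈ ({0} : Finset ℕ), ∑ j ∈ ({0} : Finset ℕ), κ ^ hierDist i j = 1
  simp [hierDist_self]

lemma corrSum_dead (κ : ℝ) (n : ℕ) : corrSum κ (GWTree.dead n) = 0 := by
  simp [corrSum, present_dead]

lemma corrSum_node (κ : ℝ) {n : ℕ} (l r : GWTree n) : corrSum κ (GWTree.node l r) =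
    corrSum κ l + corrSum κ r + 2 * κ ^ (n + 1) * (contactSum l * contactSum r) := by
  simp only [corrSum, sum_present_node, sum_add_distrib]
  have h1 : ∑ i ∈ present n l, ∑ j ∈ present n r, κ ^ hierDist i (2 ^ n + j)
      = κ ^ (n + 1) * (contactSum l * contactSum r) := by
    rw [contactSum_eq, contactSum_eq, sum_mul_sum, mul_sum]
    refine sum_congr rfl fun i hi => ?_
    rw [mul_sum]
    refine sum_congr rfl fun j hj => ?_
    rw [hierDist_cross (lt_of_mem_present _ hi) (lt_of_mem_present _ hj)]; ring
  have h2 : ∑ i ∈ present n r, ∑ j ∈ present n l, κ ^ hierDist (2 ^ n + i) j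
      = κ ^ (n + 1) * (contactSum l * contactSum r) := by
    rw [← h1, sum_comm]; simp only [hierDist_comm]
  have h3 : ∑ i ∈ present n r, ∑ j ∈ present n r, κ ^ hierDist (2 ^ n + i) (2 ^ n + j)
      = ∑ i ∈ present n r, ∑ j ∈ present n r, κ ^ hierDist i j :=
    sum_congr rfl fun i hi => sum_congr rfl fun j hj => by
      rw [hierDist_shift (lt_of_mem_present _ hi) (lt_of_mem_present _ hj)]
  rw [h1, h2, h3]; ring

lemma corrSum_nonneg {κ : ℝ} (hκ : 0 ≤ κ) {n : ℕ} (T : GWTree n) : 0 ≤ corrSum κ T :=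
  sum_nonneg fun _ _ => sum_nonneg fun _ _ => by positivity

/-- Since each half has at most `2 ^ n` contacts, the cross term `2 κ^(n+1) S_l S_r` is at most
`(2κ)^(n+1) (S_l + S_r)`: generation `n + 1` adds one term of a geometric series. -/
lemma corrSum_le_geom {κ : ℝ} (hκ : 0 ≤ κ) : ∀ {n : ℕ} (T : GWTree n),
    corrSum κ T ≤ (∑ i ∈ range (n + 1), (2 * κ) ^ i) * contactSum T
  | 0, T => by rw [corrSum_zero, contactSum_zero]; simp
  | n + 1, T => by
    rcases T.cases with rfl | ⟨l, r, rfl⟩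
    · rw [corrSum_dead, contactSum_dead, mul_zero]
    · rw [corrSum_node, contactSum_node, sum_range_succ _ (n + 1)]
      have h1 := corrSum_le_geom hκ l
      have h2 := corrSum_le_geom hκ r
      have h3 := contactSum_le l
      have h4 := contactSum_le r
      have h5 := contactSum_nonneg l
      have h6 := contactSum_nonneg r
      have h7 : 0 ≤ κ ^ (n + 1) := by positivity
      have h8 : 2 * (contactSum l * contactSum r) ≤ 2 ^ (n + 1) * (contactSum l + contactSum r) := by
        rw [pow_succ]; nlinarith
      have h9 := mul_le_mul_of_nonneg_left h8 h7
      rw [mul_pow]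
      nlinarith

lemma corrSum_le {κ : ℝ} (hκ : 0 ≤ κ) (hκ' : κ < 1 / 2) {n : ℕ} (T : GWTree n) :
    corrSum κ T ≤ contactSum T / (1 - 2 * κ) := by
  refine (corrSum_le_geom hκ T).trans ?_
  rw [div_eq_inv_mul]
  refine mul_le_mul_of_nonneg_right ?_ (contactSum_nonneg T)
  rw [← tsum_geometric_of_lt_one (by linarith) (by linarith)]
  exact (summable_geometric_of_lt_one (by linarith) (by linarith)).sum_le_tsum _
    fun _ _ => by positivity

lemma annealedHamiltonian_eq (κ β h : ℝ) {n : ℕ} (T : GWTree n) :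
    annealedHamiltonian κ β h T = h * contactSum T + β ^ 2 / 2 * corrSum κ T := by
  rw [annealedHamiltonian, contactSum, corrSum]
  congr 2
  have h1 (i : ℕ) : ∑ j ∈ range (2 ^ n), κ ^ hierDist i j * contact T i * contact T j =
      (∑ j ∈ range (2 ^ n), κ ^ hierDist i j * contact T j) * contact T i := by
    rw [sum_mul]; exact sum_congr rfl fun _ _ => by ring
  simp only [h1]
  rw [sum_contact_mul T fun i => ∑ j ∈ range (2 ^ n), κ ^ hierDist i j * contact T j]
  simp only [sum_contact_mul]

lemma annealedHamiltonian_zero (κ β h : ℝ) (T : GWTree 0) :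
    annealedHamiltonian κ β h T = h + β ^ 2 / 2 := by
  rw [annealedHamiltonian_eq, corrSum_zero, contactSum_zero]; ring

lemma annealedHamiltonian_dead (κ β h : ℝ) (n : ℕ) :
    annealedHamiltonian κ β h (GWTree.dead n) = 0 := by
  rw [annealedHamiltonian_eq, corrSum_dead, contactSum_dead]; ring

lemma annealedHamiltonian_node (κ β h : ℝ) {n : ℕ} (l r : GWTree n) :
    annealedHamiltonian κ β h (GWTree.node l r) = annealedHamiltonian κ β h l +
      annealedHamiltonian κ β h r + β ^ 2 * κ ^ (n + 1) * (contactSum l * contactSum r) := by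
  simp only [annealedHamiltonian_eq, corrSum_node, contactSum_node]; ring

lemma annealedHamiltonian_add (κ β h u : ℝ) {n : ℕ} (T : GWTree n) :
    annealedHamiltonian κ β (h + u) T = u * contactSum T + annealedHamiltonian κ β h T := by
  simp only [annealedHamiltonian_eq]; ring

lemma annealedHamiltonian_pure (κ h : ℝ) {n : ℕ} (T : GWTree n) :
    annealedHamiltonian κ 0 h T = h * contactSum T := by
  rw [annealedHamiltonian_eq]; ring

/-! ### The annealed partition function -/

/-- The annealed partition function, as an expectation over trees. -/
noncomputable def treePart (B κ β h : ℝ) (n : ℕ) : ℝ :=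
  gwExp B n fun T => Real.exp (annealedHamiltonian κ β h T)

/-- The recursion for `Z` is the decomposition at the root: no child contributes `(B - 1) / B`, two
children contribute the product of two independent subtrees with weight `1 / B`. -/
lemma blockPartition_eq_gwExp (B β h : ℝ) (w : ℕ → ℝ) (n i : ℕ) :
    blockPartition B β h w n i =
      gwExp B n fun T => Real.exp (∑ k ∈ present n T, (β * w (2 ^ n * i + k) + h)) := by
  induction n generalizing i with
  | zero =>
    rw [gwExp_zero]
    change _ = Real.exp (∑ k ∈ ({0} : Finset ℕ), (β * w (2 ^ 0 * i + k) + h))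
    simp [blockPartition]
  | succ n ih =>
    rw [blockPartition, ih, ih, gwExp_succ, present_dead]
    simp only [sum_present_node, Real.exp_add, gwExp_gwExp_mul]
    have e1 (k : ℕ) : 2 ^ n * (2 * i) + k = 2 ^ (n + 1) * i + k := by ring
    have e2 (k : ℕ) : 2 ^ n * (2 * i + 1) + k = 2 ^ (n + 1) * i + (2 ^ n + k) := by ring
    simp only [e1, e2, sum_empty, Real.exp_zero]
    ring

/-! ### Integrating out the Gaussian disorder. -/

section gaussian
variable {Ω : Type*} [MeasurableSpace Ω] {P : Measure Ω} {ω : ℕ → Ω → ℝ} {κ : ℝ}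

lemma IsHierarchicalDisorder.mgf_sum (hω : IsHierarchicalDisorder κ ω P) (hκ : 0 ≤ κ) (β : ℝ)
    (I : Finset ℕ) : mgf (fun x => ∑ i ∈ I, ω i x) P β =
      Real.exp (β ^ 2 / 2 * ∑ i ∈ I, ∑ j ∈ I, κ ^ hierDist i j) := by
  have hG : HasGaussianLaw (fun x => ∑ i ∈ I, ω i x) P := hω.gaussian.hasGaussianLaw_fun_sum
  have hL2 (i) : MemLp (ω i) 2 P := (hω.gaussian.hasGaussianLaw_eval i).memLp_two
  have := hω.gaussian.isProbabilityMeasure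
  have hmean : ∫ x, ∑ i ∈ I, ω i x ∂P = 0 := by
    rw [integral_finsetSum _ fun a _ => (hL2 a).integrable (by norm_num)]
    simp [hω.centered]
  have hvar : Var[fun x => ∑ i ∈ I, ω i x; P] = ∑ i ∈ I, ∑ j ∈ I, κ ^ hierDist i j := by
    rw [variance_of_integral_eq_zero hG.aemeasurable hmean]
    have (x : Ω) : (∑ i ∈ I, ω i x) ^ 2 = ∑ i ∈ I, ∑ j ∈ I, ω i x * ω j x := by
      rw [sq, sum_mul_sum]
    simp only [this]
    have hint (a b) : Integrable (fun x => ω a x * ω b x) P := (hL2 a).integrable_mul (hL2 b)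
    rw [integral_finsetSum _ fun a _ => integrable_finsetSum _ fun b _ => hint a b]
    refine sum_congr rfl fun i _ => ?_
    rw [integral_finsetSum _ fun b _ => hint i b]
    exact sum_congr rfl fun j _ => hω.covariance i j
  rw [mgf_gaussianReal hG.map_eq_gaussianReal, hmean, hvar, Real.coe_toNNReal]
  · congr 1; ring
  · exact sum_nonneg fun _ _ => sum_nonneg fun _ _ => by positivity

lemma IsHierarchicalDisorder.annealedPartition_eq (hω : IsHierarchicalDisorder κ ω P)
    (hκ : 0 ≤ κ) (B β h : ℝ) (n : ℕ) :
    annealedPartition P ω B β h n = treePart B κ β h n := by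
  have := hω.gaussian.isProbabilityMeasure
  have hexp (T : GWTree n) (x : Ω) :
      Real.exp (∑ k ∈ present n T, (β * ω (2 ^ n * 0 + k) x + h)) =
        Real.exp (h * contactSum T) * Real.exp (β * ∑ k ∈ present n T, ω k x) := by
    rw [← Real.exp_add, contactSum_eq, mul_sum, mul_sum, ← sum_add_distrib]
    congr 1
    exact sum_congr rfl fun k _ => by rw [mul_zero, zero_add]; ring
  have hint (T : GWTree n) :
      Integrable (fun x => Real.exp (β * ∑ k ∈ present n T, ω k x)) P := by
    rw [← mgf_pos_iff, hω.mgf_sum hκ]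
    exact Real.exp_pos _
  simp only [annealedPartition, blockPartition_eq_gwExp, hexp]
  simp only [gwExp, treePart]
  rw [integral_finsetSum _ fun T _ => ((hint T).const_mul _).const_mul _]
  refine sum_congr rfl fun T _ => ?_
  rw [integral_const_mul, integral_const_mul]
  have := hω.mgf_sum hκ β (present n T)
  rw [mgf] at this
  rw [this, annealedHamiltonian_eq, Real.exp_add]
  rfl

end gaussian

/-! ### The free energy -/

/-- The free energy at size `2 ^ n`. -/
noncomputable def treeFree (B κ β h : ℝ) (n : ℕ) : ℝ :=
  1 / 2 ^ n * Real.log (treePart B κ β h n)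

lemma treePart_pure (B κ h : ℝ) (n : ℕ) :
    treePart B κ 0 h n = gwExp B n fun T => Real.exp (h * contactSum T) := by
  simp only [treePart, annealedHamiltonian_pure]

section treePart
variable {B κ β : ℝ}

lemma treePart_pos (hB : 1 ≤ B) (h : ℝ) (n : ℕ) : 0 < treePart B κ β h n :=
  gwExp_pos hB fun _ => Real.exp_pos _

lemma treePart_mono (hB : 1 ≤ B) {h h' : ℝ} (hh : h ≤ h') (n : ℕ) :
    treePart B κ β h n ≤ treePart B κ β h' n := by
  refine gwExp_mono hB fun T => Real.exp_le_exp.2 ?_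
  simp only [annealedHamiltonian_eq]
  have := mul_le_mul_of_nonneg_right hh (contactSum_nonneg T)
  linarith

lemma treePart_add_le (hB : 1 ≤ B) {u : ℝ} (hu : 0 ≤ u) (h : ℝ) (n : ℕ) :
    treePart B κ β (h + u) n ≤ Real.exp (u * 2 ^ n) * treePart B κ β h n := by
  rw [treePart, treePart, ← gwExp_mul_left]
  refine gwExp_mono hB fun T => ?_
  rw [← Real.exp_add, annealedHamiltonian_add]
  have := mul_le_mul_of_nonneg_left (contactSum_le T) hu
  exact Real.exp_le_exp.2 (by linarith)

lemma one_le_treePart (hB : 1 ≤ B) (hκ : 0 ≤ κ) {h : ℝ} (hh : 0 ≤ h) (n : ℕ) :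
    1 ≤ treePart B κ β h n := by
  rw [← gwExp_const hB n 1]
  refine gwExp_mono hB fun T => Real.one_le_exp ?_
  rw [annealedHamiltonian_eq]
  have := contactSum_nonneg T
  have := corrSum_nonneg hκ T
  positivity

lemma treePart_le_one (hB : 1 ≤ B) (hκ : 0 ≤ κ) (hκ' : κ < 1 / 2) {h : ℝ}
    (hh : h ≤ -(β ^ 2 / 2 / (1 - 2 * κ))) (n : ℕ) : treePart B κ β h n ≤ 1 := by
  rw [← gwExp_const hB n 1]
  refine gwExp_mono hB fun T => Real.exp_le_one_iff.2 ?_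
  rw [annealedHamiltonian_eq]
  have h1 := mul_le_mul_of_nonneg_left (corrSum_le hκ hκ' T) (by positivity : 0 ≤ β ^ 2 / 2)
  have h2 := mul_le_mul_of_nonneg_right hh (contactSum_nonneg T)
  have h3 : β ^ 2 / 2 * (contactSum T / (1 - 2 * κ)) =
    β ^ 2 / 2 / (1 - 2 * κ) * contactSum T := by ring
  linarith

lemma treePart_zero (h : ℝ) : treePart B κ β h 0 = Real.exp (h + β ^ 2 / 2) := by
  rw [treePart, gwExp_zero, annealedHamiltonian_zero]

lemma treePart_succ_pure (h : ℝ) (n : ℕ) :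
    treePart B κ 0 h (n + 1) = (B - 1) / B + 1 / B * treePart B κ 0 h n ^ 2 := by
  rw [treePart, gwExp_succ, annealedHamiltonian_dead]
  simp only [annealedHamiltonian_node, ne_eq, OfNat.ofNat_ne_zero, not_false_eq_true, zero_pow,
    zero_mul, add_zero, Real.exp_add, gwExp_gwExp_mul, treePart, Real.exp_zero]
  ring

/-- The interaction between the two halves is nonnegative, so dropping it leaves a lower bound of
pure form. -/
lemma le_treePart_succ (hB : 1 ≤ B) (hκ : 0 ≤ κ) (h : ℝ) (n : ℕ) :
    (B - 1) / B + 1 / B * treePart B κ β h n ^ 2 ≤ treePart B κ β h (n + 1) := by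
  rw [treePart, treePart, gwExp_succ, annealedHamiltonian_dead, sq, ← gwExp_gwExp_mul,
    Real.exp_zero, mul_one]
  gcongr
  refine gwExp_mono hB fun l => gwExp_mono hB fun r => ?_
  rw [← Real.exp_add, annealedHamiltonian_node]
  refine Real.exp_le_exp.2 (le_add_of_nonneg_right ?_)
  have := contactSum_nonneg l
  have := contactSum_nonneg r
  positivity

lemma treePart_le (hB : 1 ≤ B) (hκ : 0 ≤ κ) (hκ' : κ < 1 / 2) (h : ℝ) (n : ℕ) :
    treePart B κ β h n ≤ Real.exp ((|h| + β ^ 2 / 2 / (1 - 2 * κ)) * 2 ^ n) := by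
  set C := β ^ 2 / 2 / (1 - 2 * κ)
  have hC : 0 ≤ C := div_nonneg (by positivity) (by linarith)
  calc treePart B κ β h n ≤ treePart B κ β (-C + (|h| + C)) n :=
        treePart_mono hB (by have := le_abs_self h; linarith) n
    _ ≤ _ := treePart_add_le hB (by positivity) _ _
    _ ≤ _ := mul_le_of_le_one_right (Real.exp_pos _).le (treePart_le_one hB hκ hκ' le_rfl n)

/-- `2 ^ (-n) * log (Z_n / B)` is nondecreasing. -/
lemma monotone_log_treePart_div (hB : 1 < B) (hκ : 0 ≤ κ) (h : ℝ) :
    Monotone fun n : ℕ => 1 / 2 ^ n * Real.log (treePart B κ β h n / B) := by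
  refine monotone_nat_of_le_succ fun n => ?_
  -- Dropping also the term of the childless root gives `Z_(n+1) ≥ Z_n² / B`; division by `B` makes
  -- this supermultiplicative.
  have h1 : (treePart B κ β h n / B) ^ 2 ≤ treePart B κ β h (n + 1) / B := by
    rw [div_pow, sq B, ← div_div]
    gcongr
    have := le_treePart_succ (β := β) hB.le hκ h n
    have h3 : 0 ≤ (B - 1) / B := div_nonneg (by linarith) (by linarith)
    calc _ = 1 / B * treePart B κ β h n ^ 2 := by ring
      _ ≤ _ := by linarith
  have hp : 0 < treePart B κ β h n / B := div_pos (treePart_pos hB.le _ _) (by linarith)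
  have h2 := Real.log_le_log (by positivity) h1
  rw [Real.log_pow] at h2
  push_cast at h2
  calc 1 / 2 ^ n * Real.log (treePart B κ β h n / B)
      = 1 / 2 ^ (n + 1) * (2 * Real.log (treePart B κ β h n / B)) := by
        rw [pow_succ]; field_simp
    _ ≤ _ := by gcongr

lemma tendsto_one_div_two_pow : Tendsto (fun n : ℕ => 1 / (2 : ℝ) ^ n) atTop (𝓝 0) := by
  simpa using tendsto_pow_atTop_nhds_zero_of_lt_one (r := (2 : ℝ)⁻¹) (by norm_num) (by norm_num)

lemma treeFree_eq (hB : 1 < B) (h : ℝ) (n : ℕ) : treeFree B κ β h n =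
    1 / 2 ^ n * Real.log (treePart B κ β h n / B) + 1 / 2 ^ n * Real.log B := by
  rw [treeFree, Real.log_div (treePart_pos hB.le _ _).ne' (by linarith)]; ring

lemma treeFree_le (hB : 1 < B) (hκ : 0 ≤ κ) (hκ' : κ < 1 / 2) (h : ℝ) (n : ℕ) :
    treeFree B κ β h n ≤ |h| + β ^ 2 / 2 / (1 - 2 * κ) := by
  have h1 := Real.log_le_log (treePart_pos hB.le _ _) (treePart_le (β := β) hB.le hκ hκ' h n)
  rw [Real.log_exp] at h1
  rw [treeFree, one_div, inv_mul_le_iff₀ (by positivity)]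
  linarith

lemma exists_tendsto_treeFree (hB : 1 < B) (hκ : 0 ≤ κ) (hκ' : κ < 1 / 2) (β h : ℝ) :
    ∃ F, Tendsto (treeFree B κ β h) atTop (𝓝 F) := by
  have hm := monotone_log_treePart_div (β := β) hB hκ h
  have hb : BddAbove (Set.range fun n : ℕ => 1 / 2 ^ n * Real.log (treePart B κ β h n / B)) := by
    refine ⟨|h| + β ^ 2 / 2 / (1 - 2 * κ), ?_⟩
    rintro _ ⟨n, rfl⟩
    have h1 := treeFree_le (β := β) hB hκ hκ' h n
    rw [treeFree_eq hB] at h1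
    have : 0 ≤ 1 / 2 ^ n * Real.log B := mul_nonneg (by positivity) (Real.log_nonneg hB.le)
    linarith
  have h1 := (tendsto_atTop_ciSup hm hb).add (tendsto_one_div_two_pow.mul_const (Real.log B))
  exact ⟨_, h1.congr fun n => (treeFree_eq hB h n).symm⟩

/-- The limiting free energy. -/
noncomputable def freeLim (B κ β h : ℝ) : ℝ := limUnder atTop (treeFree B κ β h)

lemma tendsto_treeFree (hB : 1 < B) (hκ : 0 ≤ κ) (hκ' : κ < 1 / 2) (β h : ℝ) :
    Tendsto (treeFree B κ β h) atTop (𝓝 (freeLim B κ β h)) :=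
  tendsto_nhds_limUnder (exists_tendsto_treeFree hB hκ hκ' β h)

section freeLim
variable (hB : 1 < B) (hκ : 0 ≤ κ) (hκ' : κ < 1 / 2)
include hB hκ hκ'

lemma le_freeLim (β h : ℝ) (n : ℕ) :
    1 / 2 ^ n * Real.log (treePart B κ β h n / B) ≤ freeLim B κ β h := by
  refine ge_of_tendsto (tendsto_treeFree hB hκ hκ' β h) (eventually_atTop.2 ⟨n, fun m hm => ?_⟩)
  have := monotone_log_treePart_div (β := β) hB hκ h hm
  rw [treeFree_eq hB]
  have h1 : 0 ≤ 1 / 2 ^ m * Real.log B := mul_nonneg (by positivity) (Real.log_nonneg hB.le)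
  simp only at this
  linarith

/-- A childless root alone already contributes the constant `(B - 1) / B`, whose logarithm is killed
by `2 ^ (-n)`. -/
lemma freeLim_nonneg (β h : ℝ) : 0 ≤ freeLim B κ β h := by
  have h1 : Tendsto (fun n : ℕ => 1 / (2 : ℝ) ^ n * Real.log ((B - 1) / B)) atTop (𝓝 0) := by
    simpa using tendsto_one_div_two_pow.mul_const (Real.log ((B - 1) / B))
  refine le_of_tendsto_of_tendsto h1 (tendsto_treeFree hB hκ hκ' β h)
    (eventually_atTop.2 ⟨1, fun m hm => ?_⟩)
  obtain ⟨n, rfl⟩ := Nat.exists_eq_add_of_le' hm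
  refine mul_le_mul_of_nonneg_left (Real.log_le_log ?_ ?_) (by positivity)
  · exact div_pos (by linarith) (by linarith)
  · have := le_treePart_succ (β := β) hB.le hκ h n
    have h2 : 0 ≤ 1 / B * treePart B κ β h n ^ 2 :=
      mul_nonneg (by have : 0 < B := by linarith
                     positivity) (sq_nonneg _)
    linarith

lemma freeLim_mono (β : ℝ) : Monotone (freeLim B κ β) := fun h h' hh =>
  le_of_tendsto_of_tendsto' (tendsto_treeFree hB hκ hκ' β h) (tendsto_treeFree hB hκ hκ' β h')
    fun n => mul_le_mul_of_nonneg_left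
      (Real.log_le_log (treePart_pos hB.le _ _) (treePart_mono hB.le hh n)) (by positivity)

lemma freeLim_add_le (β h : ℝ) {u : ℝ} (hu : 0 ≤ u) :
    freeLim B κ β (h + u) ≤ freeLim B κ β h + u := by
  refine le_of_tendsto_of_tendsto' (tendsto_treeFree hB hκ hκ' β _)
    ((tendsto_treeFree hB hκ hκ' β h).add_const u) fun n => ?_
  have h1 := Real.log_le_log (treePart_pos hB.le _ _) (treePart_add_le (κ := κ) (β := β) hB.le hu h n)
  rw [Real.log_mul (Real.exp_pos _).ne' (treePart_pos hB.le _ _).ne', Real.log_exp] at h1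
  rw [treeFree, treeFree, one_div, inv_mul_le_iff₀ (by positivity), mul_add,
    mul_inv_cancel_left₀ (by positivity)]
  linarith

lemma freeLim_eq_zero_of_le_one {β h : ℝ} (H : ∀ n, treePart B κ β h n ≤ 1) :
    freeLim B κ β h = 0 := by
  refine le_antisymm ?_ (freeLim_nonneg hB hκ hκ' β h)
  refine le_of_tendsto' (tendsto_treeFree hB hκ hκ' β h) fun n => ?_
  exact mul_nonpos_of_nonneg_of_nonpos (by positivity)
    (Real.log_nonpos (treePart_pos hB.le _ _).le (H n))

lemma freeLim_pos_of_lt {β h : ℝ} {n : ℕ} (H : B < treePart B κ β h n) : 0 < freeLim B κ β h := by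
  refine lt_of_lt_of_le ?_ (le_freeLim hB hκ hκ' β h n)
  have : 1 < treePart B κ β h n / B := (one_lt_div (by linarith)).2 H
  have := Real.log_pos this
  positivity

/-- The set where the free energy vanishes is a closed half-line. -/
lemma freeLim_eq_zero_iff (β h : ℝ) :
    freeLim B κ β h = 0 ↔ h ≤ sSup {h : ℝ | freeLim B κ β h = 0} := by
  have hne : {h : ℝ | freeLim B κ β h = 0}.Nonempty :=
    ⟨_, freeLim_eq_zero_of_le_one hB hκ hκ' fun n => treePart_le_one hB.le hκ hκ' le_rfl n⟩
  have hbd : BddAbove {h : ℝ | freeLim B κ β h = 0} := by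
    refine ⟨Real.log B, fun h hh => ?_⟩
    by_contra! hlt
    refine (freeLim_pos_of_lt (β := β) (h := h) hB hκ hκ' (n := 0) ?_).ne' hh
    rw [treePart_zero, ← Real.log_lt_iff_lt_exp (by linarith)]
    have := sq_nonneg β
    linarith
  refine ⟨fun hh => le_csSup hbd hh, fun hh => ?_⟩
  -- The free energy is nondecreasing and grows at most as fast as `h`, so it still vanishes at the
  -- supremum.
  refine le_antisymm (le_of_forall_pos_le_add fun ε hε => ?_) (freeLim_nonneg hB hκ hκ' β h)
  obtain ⟨h', hh', hlt⟩ := exists_lt_of_lt_csSup hne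
    (show sSup {h : ℝ | freeLim B κ β h = 0} - ε < sSup {h : ℝ | freeLim B κ β h = 0} by linarith)
  calc freeLim B κ β h ≤ freeLim B κ β (h' + ε) := freeLim_mono hB hκ hκ' β (by linarith)
    _ ≤ freeLim B κ β h' + ε := freeLim_add_le hB hκ hκ' β _ hε.le
    _ = 0 + ε := by rw [hh']

end freeLim

end treePart

/-! ### The pure model -/

/-- The moments of the number of contacts. -/
noncomputable def pureMom (B : ℝ) (n k : ℕ) : ℝ := gwExp B n fun T => contactSum T ^ k

/-- The growth rate `max (2 / B) √2`. -/
noncomputable def growth (B : ℝ) : ℝ := max (2 / B) √2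

/-! ### Moments of the pure number of contacts. -/

section moments
variable {B : ℝ}

lemma pureMom_level_zero (k : ℕ) : pureMom B 0 k = 1 := by
  rw [pureMom, gwExp_zero, contactSum_zero, one_pow]

lemma pureMom_order_zero (hB : 1 ≤ B) (n : ℕ) : pureMom B n 0 = 1 := by
  simp only [pureMom, pow_zero, gwExp_const hB]

lemma gwExp_add_pow (n k : ℕ) :
    (gwExp B n fun l => gwExp B n fun r => (contactSum l + contactSum r) ^ k) =
      ∑ j ∈ range (k + 1), k.choose j * (pureMom B n j * pureMom B n (k - j)) := by
  simp only [add_pow, gwExp_sum]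
  refine sum_congr rfl fun j _ => ?_
  rw [pureMom, pureMom, ← gwExp_gwExp_mul]
  simp only [← gwExp_mul_left]
  congr with l; congr with r; ring

lemma pureMom_succ (n : ℕ) {k : ℕ} (hk : 1 ≤ k) : pureMom B (n + 1) k =
    1 / B * ∑ j ∈ range (k + 1), k.choose j * (pureMom B n j * pureMom B n (k - j)) := by
  rw [pureMom, gwExp_succ, contactSum_dead, zero_pow (by omega), mul_zero, zero_add]
  simp only [contactSum_node, gwExp_add_pow]

lemma pureMom_one (hB : 1 ≤ B) (n : ℕ) : pureMom B n 1 = (2 / B) ^ n := by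
  induction n with
  | zero => rw [pureMom_level_zero, pow_zero]
  | succ n ih =>
    rw [pureMom_succ n le_rfl]
    simp [sum_range_succ, ih, pureMom_order_zero hB]
    ring

/-- The second moment satisfies `m_(n+1) = (2/B) (m_n + (4/B²)^n)`, and `c = B / (2 - B)` solves `c
· 4/B² = (2/B) (c + 1)`. -/
lemma pureMom_two_le (hB : 1 < B) (hB' : B < 2) (n : ℕ) :
    pureMom B n 2 ≤ B / (2 - B) * (4 / B ^ 2) ^ n := by
  induction n with
  | zero =>
    rw [pureMom_level_zero, pow_zero, mul_one, le_div_iff₀ (by linarith)]; linarith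
  | succ n ih =>
    have h1 : pureMom B (n + 1) 2 = 2 / B * (pureMom B n 2 + (4 / B ^ 2) ^ n) := by
      have h4 : (4 / B ^ 2) ^ n = (2 / B) ^ n * (2 / B) ^ n := by
        rw [← mul_pow]; congr 1; ring
      rw [pureMom_succ n one_le_two, h4]
      simp [sum_range_succ, pureMom_one hB.le, pureMom_order_zero hB.le]
      ring
    have hb : 0 < B := by linarith
    have hb2 : (2 - B) ≠ 0 := by linarith
    calc _ ≤ 2 / B * (B / (2 - B) * (4 / B ^ 2) ^ n + (4 / B ^ 2) ^ n) := by rw [h1]; gcongr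
      _ = _ := by
        rw [pow_succ (4 / B ^ 2) n]
        generalize (4 / B ^ 2) ^ n = y
        field_simp
        ring

lemma pow_le_pureMom (hB : 1 ≤ B) (n k : ℕ) : ((2 / B) ^ n) ^ k ≤ pureMom B n k := by
  rw [← pureMom_one hB]
  simp only [pureMom, pow_one]
  exact Real.pow_arith_mean_le_arith_mean_pow _ _ _ (fun T _ => gwProb_nonneg hB n T)
    (by simpa [gwExp] using gwExp_const hB n 1) (fun T _ => contactSum_nonneg T) k

lemma pureMom_pos (hB : 1 ≤ B) (n k : ℕ) : 0 < pureMom B n k :=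
  lt_of_lt_of_le (by have : 0 < B := by linarith
                     positivity) (pow_le_pureMom hB n k)

/-- All `2 ^ p - 1` individuals of the first `p` generations reproduce with probability `B ^ (-(2 ^
p - 1))`. There are then `2 ^ p` independent trees of mean `(2/B)^n`, and Jensen bounds the `k`-th
moment of their total. -/
lemma le_pureMom_add (hB : 1 ≤ B) (n p k : ℕ) :
    (1 / B) ^ (2 ^ p - 1) * (2 ^ p * (2 / B) ^ n) ^ k ≤ pureMom B (n + p) k := by
  have hb : 0 < B := by linarith
  induction p generalizing k with
  | zero => simpa using pow_le_pureMom hB n k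
  | succ p ih =>
    set q := 2 ^ p * (2 / B) ^ n
    set w := (1 / B) ^ (2 ^ p - 1)
    have hw : (1 / B) ^ (2 ^ (p + 1) - 1) = 1 / B * (w * w) := by
      rw [← pow_add, ← pow_succ']
      congr 1
      have := Nat.one_le_two_pow (n := p)
      rw [pow_succ]; omega
    have h1 : pureMom B (n + (p + 1)) k ≥ 1 / B *
        ∑ j ∈ range (k + 1), k.choose j * (pureMom B (n + p) j * pureMom B (n + p) (k - j)) := by
      rcases Nat.eq_zero_or_pos k with rfl | hk
      · simp only [zero_add, range_one, sum_singleton, Nat.choose_self, pureMom_order_zero hB]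
        rw [Nat.cast_one, mul_one, mul_one, mul_one, ge_iff_le, div_le_one hb]
        exact hB
      · rw [← add_assoc, pureMom_succ _ hk]
    refine le_trans ?_ h1
    calc _ = 1 / B * ((w * w) * (q + q) ^ k) := by
          rw [hw, pow_succ]; simp only [q]; ring
      _ = 1 / B * ∑ j ∈ range (k + 1), k.choose j * ((w * q ^ j) * (w * q ^ (k - j))) := by
          rw [add_pow, mul_sum]
          congr 1
          exact sum_congr rfl fun j _ => by ring
      _ ≤ _ := by
          gcongr with j hj
          · exact (pureMom_pos hB _ _).le
          · exact ih j
          · exact ih _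

end moments

/-! ### The generating function of the pure model. -/

section generating
variable {B κ : ℝ}

/-- At height `n + 1` the variable `v` becomes `s = v B / 2` at height `n`. Squaring `1 + s + D s²`
with `s D ≤ 1` returns a bound of the same shape because `D = 2B / (2 - B)` solves `(4 + 2D) B / 4 =
D`. -/
lemma pure_gen_le (hB : 1 < B) (hB' : B < 2) (n : ℕ) {v : ℝ} (hv : 0 ≤ v)
    (hv' : v ≤ (2 - B) / (2 * B)) :
    treePart B κ 0 (v * (B / 2) ^ n) n ≤ 1 + v + 2 * B / (2 - B) * v ^ 2 := by
  have hb : 0 < 2 - B := by linarith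
  have hb0 : 0 < B := by linarith
  set D := 2 * B / (2 - B) with hD
  have hD1 : 1 ≤ D := by rw [hD, le_div_iff₀ hb]; linarith
  have hDB : D * (2 - B) = 2 * B := by rw [hD]; field_simp
  have hvD : v * D ≤ 1 := by
    rw [hD]; rw [le_div_iff₀ (by positivity)] at hv'
    rw [mul_div_assoc', div_le_one hb]; exact hv'
  induction n generalizing v with
  | zero =>
    rw [treePart_zero, pow_zero, mul_one]
    have hv1 : v ≤ 1 := by nlinarith
    have := Real.exp_bound' hv hv1 (n := 2) (by norm_num)
    simp [sum_range_succ] at this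
    norm_num
    nlinarith [sq_nonneg v]
  | succ n ih =>
    set s := v * (B / 2) with hs
    have hs0 : 0 ≤ s := by positivity
    have hsv : s ≤ v := by rw [hs]; nlinarith
    have hsD : s * D ≤ 1 := (mul_le_mul_of_nonneg_right hsv (by linarith)).trans hvD
    have h1 := ih hs0 (hsv.trans hv') hsD
    have e : v * (B / 2) ^ (n + 1) = s * (B / 2) ^ n := by rw [hs, pow_succ]; ring
    rw [treePart_succ_pure, e]
    have h2 : treePart B κ 0 (s * (B / 2) ^ n) n ^ 2 ≤ (1 + s + D * s ^ 2) ^ 2 :=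
      pow_le_pow_left₀ (treePart_pos hB.le _ _).le h1 2
    calc _ ≤ (B - 1) / B + 1 / B * (1 + s + D * s ^ 2) ^ 2 := by gcongr
      _ ≤ (B - 1) / B + 1 / B * (1 + 2 * s + (4 + 2 * D) * s ^ 2) := by
        gcongr
        have h3 : s * D * (s * D) ≤ 1 := by nlinarith [mul_nonneg hs0 (by linarith : 0 ≤ D)]
        have e2 : (1 + s + D * s ^ 2) ^ 2 =
          1 + 2 * s + (1 + 2 * D + 2 * (s * D) + s * D * (s * D)) * s ^ 2 := by ring
        rw [e2]
        refine add_le_add le_rfl (mul_le_mul_of_nonneg_right ?_ (sq_nonneg s))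
        linarith
      _ = 1 + v + (4 + 2 * D) * B / 4 * v ^ 2 := by rw [hs]; field_simp; ring
      _ = _ := by
        have : (4 + 2 * D) * B / 4 = D := by linarith
        rw [this]

lemma pure_gen_le_three (hB : 1 < B) (hB' : B < 2) (n : ℕ) :
    treePart B κ 0 ((2 - B) / (2 * B) * (B / 2) ^ n) n ≤ 3 := by
  have hb : 0 < 2 - B := by linarith
  have hb0 : 0 < B := by linarith
  refine (pure_gen_le hB hB' n (by positivity) le_rfl).trans ?_
  have h1 : (2 - B) / (2 * B) ≤ 1 := by rw [div_le_one (by positivity)]; linarith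
  have h2 : 2 * B / (2 - B) * ((2 - B) / (2 * B)) ^ 2 = (2 - B) / (2 * B) := by field_simp
  rw [h2]; linarith

/-- For `u ≥ 0` the generating function is at least `1`, so averaging its square with `1` does not
exceed the square. -/
lemma pure_gen_add_le (hB : 1 < B) {u : ℝ} (hu : 0 ≤ u) (n p : ℕ) :
    treePart B 0 0 u (n + p) ≤ treePart B 0 0 u n ^ 2 ^ p := by
  induction p with
  | zero => simp
  | succ p ih =>
    have h1 := one_le_treePart (κ := 0) (β := 0) hB.le le_rfl hu (n + p)
    rw [← add_assoc, treePart_succ_pure, pow_succ 2 p, pow_mul]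
    calc _ ≤ treePart B 0 0 u (n + p) ^ 2 := by
          have hb : 0 < B := by linarith
          have h2 : 1 ≤ treePart B 0 0 u (n + p) ^ 2 := one_le_pow₀ h1
          have : (B - 1) / B * 1 ≤ (B - 1) / B * treePart B 0 0 u (n + p) ^ 2 := by
            gcongr
          have e : treePart B 0 0 u (n + p) ^ 2 = (B - 1) / B * treePart B 0 0 u (n + p) ^ 2 +
            1 / B * treePart B 0 0 u (n + p) ^ 2 := by field_simp; ring
          linarith
      _ ≤ _ := pow_le_pow_left₀ (by linarith) ih 2

lemma pure_gen_scale_le (hB : 1 < B) (hB' : B < 2) (n p : ℕ) {u : ℝ} (hu : 0 ≤ u)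
    (hu' : u ≤ (2 - B) / (2 * B) * (B / 2) ^ n) : treePart B 0 0 u (n + p) ≤ 3 ^ 2 ^ p :=
  (pure_gen_add_le hB hu n p).trans (pow_le_pow_left₀ (treePart_pos hB.le _ _).le
    ((treePart_mono hB.le hu' n).trans (pure_gen_le_three hB hB' n)) _)

/-- From `x^k / k! ≤ e^x` at `x = u S`, and `k! ≤ k^k`. -/
lemma pureMom_le_gen (hB : 1 ≤ B) (n k : ℕ) {u : ℝ} (hu : 0 < u) :
    pureMom B n k ≤ (k / u) ^ k * treePart B 0 0 u n := by
  rw [treePart_pure, pureMom, ← gwExp_mul_left]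
  refine gwExp_mono hB fun T => ?_
  have hS := contactSum_nonneg T
  have h1 := Real.pow_div_factorial_le_exp (u * contactSum T) (by positivity) k
  rw [div_le_iff₀ (by positivity)] at h1
  have h2 : (k.factorial : ℝ) ≤ k ^ k := by exact_mod_cast Nat.factorial_le_pow k
  have h3 : contactSum T ^ k = (1 / u) ^ k * (u * contactSum T) ^ k := by
    rw [← mul_pow]; congr 1; field_simp
  calc _ ≤ (1 / u) ^ k * (Real.exp (u * contactSum T) * k ^ k) := by
        rw [h3]; gcongr; exact h1.trans (by gcongr)
    _ = _ := by rw [div_pow, div_pow]; ring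

end generating

/-! ### The doubling estimate for pure moments. -/

section doubling
variable {B : ℝ}

lemma sqrt_two_le_growth : √2 ≤ growth B := le_max_right _ _

lemma two_div_le_growth : 2 / B ≤ growth B := le_max_left _ _

lemma one_le_growth : 1 ≤ growth B :=
  le_trans (by rw [Real.one_le_sqrt]; norm_num) sqrt_two_le_growth

/-- The generations are cut as `n = q + p` with `2 ^ p ≤ k < 2 ^ (p + 1)`. With `s = (2/B)^q`, a
moment of order `2k` is at most `(C k² s²)^k`, by the generating function at `u` of order `1 / s`,
where it is at most `3 ^ 2 ^ p ≤ 3 ^ k`. Full branching during `p` generations bounds the moment of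
order `k` below by `(c k s)^k`. The quotient is `(C k s)^k`, and `k` of order `√k √2^p` gives `k s ≤
2 √k g^n`: the rate is `√2` for the top `p` generations and `2 / B` for the others. -/
lemma pureMom_two_mul_le (hB : 1 < B) (hB' : B < 2) {n k : ℕ} (hk : 1 ≤ k) (hkn : k ≤ 2 ^ n) :
    pureMom B n (2 * k) ≤
      (48 * B * (2 * B / (2 - B)) ^ 2 * (√k * growth B ^ n)) ^ k * pureMom B n k := by
  have hb : 0 < 2 - B := by linarith
  have hb0 : 0 < B := by linarith
  set D := 2 * B / (2 - B) with hD
  have hD0 : 0 < D := by positivity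
  have hD' : (2 - B) / (2 * B) = 1 / D := by rw [hD]; field_simp
  set p := Nat.log 2 k
  have hp1 : 2 ^ p ≤ k := Nat.pow_log_le_self 2 (by omega)
  have hp2 : k < 2 ^ (p + 1) := Nat.lt_pow_succ_log_self (by norm_num) k
  have hpn : p ≤ n := (Nat.pow_le_pow_iff_right (by norm_num)).1 (hp1.trans hkn)
  obtain ⟨q, rfl⟩ := Nat.exists_eq_add_of_le' hpn
  set s := (2 / B) ^ q with hs
  have hs0 : 0 < s := by positivity
  have hk0 : (0 : ℝ) < k := by exact_mod_cast hk
  have hkp : (k : ℝ) ≤ 2 * 2 ^ p := by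
    have : k ≤ 2 * 2 ^ p := by rw [pow_succ] at hp2; omega
    exact_mod_cast this
  set u := 1 / D * (B / 2) ^ q with hu
  have hus : 1 / u = D * s := by
    rw [hu, hs, show B / 2 = (2 / B)⁻¹ by rw [inv_div], inv_pow]; field_simp
  have hu0 : 0 < u := by positivity
  have up : pureMom B (q + p) (2 * k) ≤ (12 * k ^ 2 * D ^ 2 * s ^ 2) ^ k := by
    calc _ ≤ (((2 * k : ℕ) : ℝ) / u) ^ (2 * k) * treePart B 0 0 u (q + p) :=
          pureMom_le_gen hB.le _ _ hu0
      _ ≤ (((2 * k : ℕ) : ℝ) / u) ^ (2 * k) * 3 ^ k := by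
          gcongr
          refine (pure_gen_scale_le hB hB' q p hu0.le (by rw [hD'])).trans ?_
          exact pow_le_pow_right₀ (by norm_num) hp1
      _ = _ := by
          rw [div_eq_mul_one_div, hus, pow_mul, ← mul_pow]
          congr 1; push_cast; ring
  have low : (1 / B * (k / 2 * s)) ^ k ≤ pureMom B (q + p) k := by
    refine le_trans ?_ (le_pureMom_add hB.le q p k)
    rw [mul_pow]
    have h1 : (1 / B) ^ k ≤ (1 / B) ^ (2 ^ p - 1) :=
      pow_le_pow_of_le_one (by positivity) (by rw [div_le_one hb0]; exact hB.le) (by omega)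
    have h2 : (k / 2 * s) ^ k ≤ (2 ^ p * s) ^ k := by
      gcongr; linarith
    exact mul_le_mul h1 h2 (by positivity) (by positivity)
  have hks : k * s ≤ 2 * (√k * growth B ^ (q + p)) := by
    have h0 : (0 : ℝ) ≤ √2 := Real.sqrt_nonneg 2
    have h2 : √2 ≤ 2 := by rw [Real.sqrt_le_left (by norm_num)]; norm_num
    have h1 : √k ≤ √2 * √2 ^ p := by
      rw [Real.sqrt_le_left (by positivity), mul_pow, ← pow_mul, mul_comm p 2, pow_mul,
        Real.sq_sqrt (by norm_num)]
      exact hkp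
    have h3 : √2 ^ p ≤ growth B ^ p := pow_le_pow_left₀ h0 sqrt_two_le_growth p
    have h4 : s ≤ growth B ^ q := pow_le_pow_left₀ (by positivity) two_div_le_growth q
    have h5 : (0 : ℝ) ≤ growth B := by linarith [one_le_growth (B := B)]
    calc (k : ℝ) * s = √k * √k * s := by rw [Real.mul_self_sqrt hk0.le]
      _ ≤ √k * (2 * growth B ^ p) * growth B ^ q := by
          gcongr
          exact h1.trans (by gcongr)
      _ = _ := by rw [pow_add]; ring
  calc _ ≤ (12 * k ^ 2 * D ^ 2 * s ^ 2) ^ k := up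
    _ = (24 * B * D ^ 2 * (k * s)) ^ k * (1 / B * (k / 2 * s)) ^ k := by
        rw [← mul_pow]; congr 1; field_simp; ring
    _ ≤ (24 * B * D ^ 2 * (2 * (√k * growth B ^ (q + p)))) ^ k * pureMom B (q + p) k := by
        have h5 : (0 : ℝ) ≤ growth B := by linarith [one_le_growth (B := B)]
        gcongr
    _ = _ := by congr 2; ring

end doubling

/-! ### The pure critical exponent. -/

section exponent
variable {B : ℝ} (hB : 1 < B) (hB' : B < 2)
include hB hB'

lemma one_le_exponent : 1 ≤ Real.log 2 / Real.log (2 / B) := by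
  have hb : 0 < B := by linarith
  rw [one_le_div (Real.log_pos ((one_lt_div hb).2 hB'))]
  exact Real.log_le_log (by positivity) (by rw [div_le_iff₀ hb]; linarith)

lemma half_pow_rpow (j : ℕ) :
    ((B / 2) ^ j) ^ (Real.log 2 / Real.log (2 / B)) = 1 / 2 ^ j := by
  have hb : 0 < B := by linarith
  have h1 : Real.log (2 / B) ≠ 0 := (Real.log_pos ((one_lt_div hb).2 hB')).ne'
  have h2 : Real.log (B / 2) = -Real.log (2 / B) := by rw [← Real.log_inv, inv_div]
  have h3 : (B / 2) ^ (Real.log 2 / Real.log (2 / B)) = 1 / 2 := by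
    rw [Real.rpow_def_of_pos (by positivity), h2, one_div, ← Real.exp_log (by norm_num : (0:ℝ) < 2⁻¹),
      Real.log_inv]
    congr 1; field_simp
  rw [← Real.rpow_natCast, ← Real.rpow_mul (by positivity), mul_comm, Real.rpow_mul (by positivity),
    h3, Real.rpow_natCast, div_pow, one_pow]

/-- At the scale `j` with `u ≤ v (B/2)^j`, the generating function is at most `3`, and at most `3 ^
2 ^ p` after `p` more generations, so the free energy is at most `2^(-j) log 3`. For `u ≥ v` the
linear bound is enough because `ν ≥ 1`. -/
lemma exists_pure_freeLim_le : ∃ c > 0, ∀ u : ℝ, 0 ≤ u →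
    freeLim B 0 0 u ≤ c * u ^ (Real.log 2 / Real.log (2 / B)) := by
  have hb : 0 < 2 - B := by linarith
  have hb0 : 0 < B := by linarith
  set ν := Real.log 2 / Real.log (2 / B) with hν
  have hν1 : 1 ≤ ν := one_le_exponent hB hB'
  have hhalf := half_pow_rpow hB hB'
  rw [← hν] at hhalf
  set v := (2 - B) / (2 * B) with hv
  have hv0 : 0 < v := by positivity
  have hF0 : freeLim B 0 0 0 = 0 := freeLim_eq_zero_of_le_one hB le_rfl (by norm_num) fun n =>
    treePart_le_one hB.le le_rfl (by norm_num) (by norm_num) n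
  refine ⟨(2 / B / v) ^ ν * Real.log 3 + (1 / v) ^ ν, by
    have := Real.log_pos (by norm_num : (1:ℝ) < 3); positivity, fun u hu => ?_⟩
  have hl3 : 0 < Real.log 3 := Real.log_pos (by norm_num)
  rcases hu.eq_or_lt with rfl | hu0
  · rw [hF0]; positivity
  rcases le_or_gt v u with h | h
  · have h1 : 1 ≤ 1 / v * u := by rw [one_div, inv_mul_eq_div, one_le_div hv0]; exact h
    have hv1 : v ≤ 1 := by rw [hv, div_le_one (by positivity)]; linarith
    calc freeLim B 0 0 u ≤ u := by
          have := freeLim_add_le hB le_rfl (by norm_num : (0:ℝ) < 1/2) 0 0 hu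
          simpa [hF0] using this
      _ ≤ 1 / v * u := le_mul_of_one_le_left hu (by rw [one_div]; exact one_le_inv_iff₀.2 ⟨hv0, hv1⟩)
      _ ≤ (1 / v * u) ^ ν := Real.self_le_rpow_of_one_le h1 hν1
      _ = (1 / v) ^ ν * u ^ ν := Real.mul_rpow (by positivity) hu
      _ ≤ _ := by
        gcongr
        exact le_add_of_nonneg_left (by positivity)
  · obtain ⟨j, hj1, hj2⟩ := exists_nat_pow_near_of_lt_one (x := u / v) (y := B / 2) (by positivity)
      (by rw [div_le_one hv0]; exact h.le) (by positivity) (by linarith)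
    rw [lt_div_iff₀ hv0] at hj1
    rw [div_le_iff₀ hv0] at hj2
    have h1 : freeLim B 0 0 u ≤ 1 / 2 ^ j * Real.log 3 := by
      refine le_of_tendsto (tendsto_treeFree hB le_rfl (by norm_num) 0 u)
        (eventually_atTop.2 ⟨j, fun n hn => ?_⟩)
      obtain ⟨p, rfl⟩ := Nat.exists_eq_add_of_le hn
      have h2 := pure_gen_scale_le hB hB' j p hu (by rw [mul_comm]; exact hj2)
      have h3 := Real.log_le_log (treePart_pos hB.le _ _) h2
      rw [Real.log_pow] at h3
      push_cast at h3
      rw [treeFree]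
      calc _ ≤ 1 / 2 ^ (j + p) * (2 ^ p * Real.log 3) := by gcongr
        _ = _ := by rw [pow_add]; field_simp
    have h4 : (B / 2) ^ j ≤ 2 / B / v * u := by
      rw [pow_succ] at hj1
      rw [div_div, div_mul_eq_mul_div, le_div_iff₀ (by positivity)]
      nlinarith
    calc _ ≤ 1 / 2 ^ j * Real.log 3 := h1
      _ = ((B / 2) ^ j) ^ ν * Real.log 3 := by rw [hhalf]
      _ ≤ (2 / B / v * u) ^ ν * Real.log 3 := by gcongr
      _ = (2 / B / v) ^ ν * Real.log 3 * u ^ ν := by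
        rw [Real.mul_rpow (by positivity) hu]; ring
      _ ≤ _ := by
        gcongr
        exact le_add_of_nonneg_right (by positivity)

/-- At the first scale `j` where `u (2/B)^j`, the mean of `u S_j`, reaches `2B`, the generating
function exceeds `2B` and supermultiplicativity gives at least `2^(-j) log 2`. -/
lemma exists_le_pure_freeLim : ∃ c > 0, ∀ u ∈ Set.Icc (0 : ℝ) 1,
    c * u ^ (Real.log 2 / Real.log (2 / B)) ≤ freeLim B 0 0 u := by
  have hb0 : 0 < B := by linarith
  set ν := Real.log 2 / Real.log (2 / B) with hν
  have hν1 : 1 ≤ ν := one_le_exponent hB hB'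
  have hhalf := half_pow_rpow hB hB'
  rw [← hν] at hhalf
  have hl2 : 0 < Real.log 2 := Real.log_pos (by norm_num)
  refine ⟨(1 / 4) ^ ν * Real.log 2, by positivity, fun u hu => ?_⟩
  rcases hu.1.eq_or_lt with rfl | hu0
  · rw [Real.zero_rpow (by linarith), mul_zero]
    exact freeLim_nonneg hB le_rfl (by norm_num) _ _
  have hex : ∃ j : ℕ, 2 * B / u ≤ (2 / B) ^ j :=
    (pow_unbounded_of_one_lt _ ((one_lt_div hb0).2 hB')).imp fun _ h => h.le
  classical
  have hj := Nat.find_spec hex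
  have hmin := fun m => Nat.find_min hex (m := m)
  generalize Nat.find hex = j at hj hmin
  obtain _ | i := j
  -- Scale `0` is excluded by `u ≤ 1 < 2B`, so the preceding scale exists and bounds `u` by
  -- minimality.
  · rw [pow_zero, div_le_one hu0] at hj; linarith [hu.2]
  have hi := hmin i (Nat.lt_succ_self i)
  rw [not_le, lt_div_iff₀ hu0] at hi
  rw [div_le_iff₀ hu0] at hj
  have h1 : 2 * B ≤ treePart B 0 0 u (i + 1) := by
    have h2 : u * (2 / B) ^ (i + 1) ≤ treePart B 0 0 u (i + 1) := by
      rw [← pureMom_one hB.le, pureMom, ← gwExp_mul_left, treePart_pure]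
      refine gwExp_mono hB.le fun T => ?_
      rw [pow_one]
      linarith [Real.add_one_le_exp (u * contactSum T)]
    linarith
  have h3 : u / 4 ≤ (B / 2) ^ (i + 1) := by
    have e : (B / 2) ^ i * (2 / B) ^ i = 1 := by rw [← mul_pow]; field_simp; simp
    have hp : 0 < (B / 2) ^ i := by positivity
    rw [pow_succ]
    have := mul_lt_mul_of_pos_left hi hp
    rw [← mul_assoc, e] at this
    nlinarith
  calc _ = (u / 4) ^ ν * Real.log 2 := by
        rw [div_eq_mul_one_div u 4, Real.mul_rpow hu.1 (by norm_num)]; ring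
    _ ≤ ((B / 2) ^ (i + 1)) ^ ν * Real.log 2 := by
        have := hu.1
        gcongr
    _ = 1 / 2 ^ (i + 1) * Real.log 2 := by rw [hhalf]
    _ ≤ 1 / 2 ^ (i + 1) * Real.log (treePart B 0 0 u (i + 1) / B) := by
        gcongr
        rw [le_div_iff₀ hb0]; exact h1
    _ ≤ _ := le_freeLim hB le_rfl (by norm_num) _ _ _

end exponent

/-! ### Moments under the annealed weights -/

/-- The moments of the number of contacts under the annealed weights. -/
noncomputable def annMom (B κ β h : ℝ) (n k : ℕ) : ℝ :=
  gwExp B n fun T => contactSum T ^ k * Real.exp (annealedHamiltonian κ β h T)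

/-- The annealed moments of positive order are comparable to the pure ones. -/
def MomComparable (B κ β h : ℝ) (n : ℕ) (t : ℝ) : Prop :=
  ∀ k : ℕ, 1 ≤ k → Real.exp (-t * k) * pureMom B n k ≤ annMom B κ β h n k ∧
    annMom B κ β h n k ≤ Real.exp (t * k) * pureMom B n k

/-- The constant in the bound on the ratio of consecutive moments. -/
noncomputable def ratioConst (B : ℝ) : ℝ := 8 * (48 * B * (2 * B / (2 - B)) ^ 2)

section
variable {B κ β h : ℝ} {n : ℕ}

lemma annMom_order_zero : annMom B κ β h n 0 = treePart B κ β h n := by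
  simp only [annMom, pow_zero, one_mul, treePart]

lemma annMom_nonneg (hB : 1 ≤ B) (k : ℕ) : 0 ≤ annMom B κ β h n k :=
  gwExp_nonneg hB fun T => mul_nonneg (pow_nonneg (contactSum_nonneg T) _) (Real.exp_pos _).le

lemma annMom_level_zero (k : ℕ) : annMom B κ β h 0 k = treePart B κ β h 0 := by
  rw [annMom, treePart, gwExp_zero, gwExp_zero, contactSum_zero, one_pow, one_mul]

lemma annMom_pos (hB : 1 ≤ B) (hκ : 0 ≤ κ) (k : ℕ) : 0 < annMom B κ β h n k := by
  refine lt_of_lt_of_le (mul_pos (Real.exp_pos (-(|h| * 2 ^ n))) (pureMom_pos hB n k)) ?_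
  rw [pureMom, ← gwExp_mul_left]
  refine gwExp_mono hB fun T => ?_
  have hS := contactSum_nonneg T
  rw [mul_comm]
  refine mul_le_mul_of_nonneg_left (Real.exp_le_exp.2 ?_) (by positivity)
  rw [annealedHamiltonian_eq]
  have h1 := corrSum_nonneg hκ T
  have h2 : 0 ≤ β ^ 2 / 2 * corrSum κ T := by positivity
  have h3 := neg_abs_le h
  have h4 := mul_le_mul_of_nonneg_right h3 hS
  have h5 := mul_le_mul_of_nonneg_left (contactSum_le T) (abs_nonneg h)
  linarith

lemma annMom_mono (hB : 1 ≤ B) {h' : ℝ} (hh : h' ≤ h) (k : ℕ) :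
    annMom B κ β h' n k ≤ annMom B κ β h n k := by
  refine gwExp_mono hB fun T => ?_
  have hS := contactSum_nonneg T
  refine mul_le_mul_of_nonneg_left (Real.exp_le_exp.2 ?_) (by positivity)
  simp only [annealedHamiltonian_eq]
  have := mul_le_mul_of_nonneg_right hh hS
  linarith

lemma annMom_succ_le_two_pow (hB : 1 ≤ B) (k : ℕ) :
    annMom B κ β h n (k + 1) ≤ 2 ^ n * annMom B κ β h n k := by
  rw [annMom, annMom, ← gwExp_mul_left]
  refine gwExp_mono hB fun T => ?_
  have hS := contactSum_nonneg T
  have := contactSum_le T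
  rw [pow_succ']
  calc _ = contactSum T * (contactSum T ^ k * Real.exp (annealedHamiltonian κ β h T)) := by ring
    _ ≤ _ := by gcongr

/-- Log-convexity of the moments. -/
lemma annMom_ratio_pow_le (hB : 1 ≤ B) (hκ : 0 ≤ κ) (k m : ℕ) :
    (annMom B κ β h n (k + 1) / annMom B κ β h n k) ^ m ≤
      annMom B κ β h n (k + m) / annMom B κ β h n k := by
  have hM := annMom_pos (β := β) (h := h) (n := n) hB hκ k
  -- Jensen for `x ↦ x^m` under the probability proportional to `S^k e^H`.
  have key := Real.pow_arith_mean_le_arith_mean_pow univ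
    (fun T : GWTree n => gwProb B n T *
      (contactSum T ^ k * Real.exp (annealedHamiltonian κ β h T)) / annMom B κ β h n k)
    (fun T => contactSum T) (fun T _ => by
      have := gwProb_nonneg hB n T
      have := contactSum_nonneg T
      positivity) (by rw [← sum_div]; exact div_self hM.ne')
    (fun T _ => contactSum_nonneg T) m
  have e (M : ℝ) (j : ℕ) : ∑ T : GWTree n, gwProb B n T *
      (contactSum T ^ k * Real.exp (annealedHamiltonian κ β h T)) / M *
        contactSum T ^ j = annMom B κ β h n (k + j) / M := by
    rw [annMom, gwExp, sum_div]
    exact sum_congr rfl fun T _ => by rw [pow_add]; ring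
  have e1 := e (annMom B κ β h n k) 1
  simp only [pow_one] at e1
  rwa [e, e1] at key

/-- Lowering the field by `d`. -/
lemma le_annMom_sub (hB : 1 ≤ B) {R : ℝ} (d : ℝ) {k : ℕ} (hd : 0 ≤ d)
    (hR : annMom B κ β h n (k + 1) ≤ R * annMom B κ β h n k) :
    Real.exp (-(d * R)) * annMom B κ β h n k ≤ annMom B κ β (h - d) n k := by
  -- The inequality `e^x ≥ 1 + x` is used at `x = d (R - S)`: centring at `R`, which dominates the
  -- mean of `S` under the weight `S^k e^H`, leaves the factor `e^(-dR)` and a nonnegative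
  -- first-order term.
  have h1 : gwExp B n (fun T => Real.exp (-(d * R)) * ((1 + d * R) *
      (contactSum T ^ k * Real.exp (annealedHamiltonian κ β h T)) - d *
      (contactSum T ^ (k + 1) * Real.exp (annealedHamiltonian κ β h T)))) ≤
      annMom B κ β (h - d) n k := by
    refine gwExp_mono hB fun T => ?_
    have hS := contactSum_nonneg T
    have e : annealedHamiltonian κ β (h - d) T =
        -(d * R) + (d * R - d * contactSum T) + annealedHamiltonian κ β h T := by
      rw [sub_eq_add_neg, annealedHamiltonian_add]; ring
    rw [e, Real.exp_add, Real.exp_add]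
    have h2 := Real.add_one_le_exp (d * R - d * contactSum T)
    have h3 : 0 ≤ contactSum T ^ k * Real.exp (annealedHamiltonian κ β h T) *
      Real.exp (-(d * R)) := by positivity
    have h4 := mul_le_mul_of_nonneg_left h2 h3
    rw [pow_succ]
    linarith
  refine le_trans ?_ h1
  rw [gwExp_mul_left, gwExp_sub, gwExp_mul_left, gwExp_mul_left, ← annMom, ← annMom]
  refine mul_le_mul_of_nonneg_left ?_ (Real.exp_pos _).le
  have := mul_le_mul_of_nonneg_left hR hd
  linarith

lemma exp_neg_le_quadratic {x : ℝ} (hx : 0 ≤ x) : Real.exp (-x) ≤ 1 - x + x ^ 2 / 2 := by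
  have h1 := Real.quadratic_le_exp_of_nonneg hx
  have h2 : 0 < 1 + x + x ^ 2 / 2 := by positivity
  rw [Real.exp_neg]
  calc (Real.exp x)⁻¹ ≤ (1 + x + x ^ 2 / 2)⁻¹ := inv_anti₀ h2 h1
    _ ≤ _ := by
      rw [inv_le_iff_one_le_mul₀ h2]
      nlinarith [sq_nonneg (x ^ 2)]

lemma treePart_sub_le (hB : 1 ≤ B) {d : ℝ} (hd : 0 ≤ d) : treePart B κ β (h - d) n ≤
    treePart B κ β h n - d * annMom B κ β h n 1 + d ^ 2 / 2 * annMom B κ β h n 2 := by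
  simp only [treePart, annMom, ← gwExp_mul_left, ← gwExp_sub, ← gwExp_add]
  refine gwExp_mono hB fun T => ?_
  have hS := contactSum_nonneg T
  have e : annealedHamiltonian κ β (h - d) T =
      -(d * contactSum T) + annealedHamiltonian κ β h T := by
    rw [sub_eq_add_neg, annealedHamiltonian_add]; ring
  rw [e, Real.exp_add]
  have := mul_le_mul_of_nonneg_right (exp_neg_le_quadratic (mul_nonneg hd hS))
    (Real.exp_pos (annealedHamiltonian κ β h T)).le
  refine this.trans (le_of_eq ?_)
  ring

lemma le_treePart_sub (hB : 1 ≤ B) (d : ℝ) :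
    treePart B κ β h n - d * annMom B κ β h n 1 ≤ treePart B κ β (h - d) n := by
  simp only [treePart, annMom, ← gwExp_mul_left, ← gwExp_sub]
  refine gwExp_mono hB fun T => ?_
  have e : annealedHamiltonian κ β (h - d) T =
      -(d * contactSum T) + annealedHamiltonian κ β h T := by
    rw [sub_eq_add_neg, annealedHamiltonian_add]; ring
  rw [e, Real.exp_add]
  have := mul_le_mul_of_nonneg_right (Real.add_one_le_exp (-(d * contactSum T)))
    (Real.exp_pos (annealedHamiltonian κ β h T)).le
  rw [pow_one]
  linarith

lemma treePart_strictMono (hB : 1 ≤ B) (hκ : 0 ≤ κ) : StrictMono fun h => treePart B κ β h n := by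
  intro h h' hh
  have h1 := le_treePart_sub (κ := κ) (β := β) (h := h) (n := n) hB (h - h')
  have h2 := annMom_pos (β := β) (h := h) (n := n) hB hκ 1
  rw [sub_sub_cancel] at h1
  have : 0 < (h' - h) * annMom B κ β h n 1 := mul_pos (by linarith) h2
  simp only
  linarith

lemma exists_treePart_eq_one (hB : 1 ≤ B) (hκ : 0 ≤ κ) (hκ' : κ < 1 / 2) (β : ℝ) (n : ℕ) :
    ∃ h, -(β ^ 2 / 2 / (1 - 2 * κ)) ≤ h ∧ treePart B κ β h n = 1 := by
  have hc : Continuous fun h => treePart B κ β h n := by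
    simp only [treePart, gwExp, annealedHamiltonian_eq]
    fun_prop
  have hC : -(β ^ 2 / 2 / (1 - 2 * κ)) ≤ 0 :=
    neg_nonpos.2 (div_nonneg (by positivity) (by linarith))
  obtain ⟨h, hh, h1⟩ := intermediate_value_Icc hC hc.continuousOn
    ⟨treePart_le_one hB hκ hκ' le_rfl n, one_le_treePart hB hκ le_rfl n⟩
  exact ⟨h, hh.1, h1⟩

lemma one_le_ratioConst (hB : 1 < B) (hB' : B < 2) : 1 ≤ ratioConst B := by
  have h1 : 1 ≤ 2 * B / (2 - B) := by rw [le_div_iff₀ (by linarith)]; linarith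
  have h2 : 1 ≤ (2 * B / (2 - B)) ^ 2 := one_le_pow₀ h1
  rw [ratioConst]
  nlinarith

/-- Ratio of consecutive moments. -/
lemma MomComparable.ratio (hB : 1 < B) (hB' : B < 2) (hκ : 0 ≤ κ) {t : ℝ}
    (ht : t ≤ Real.log 2) (H : MomComparable B κ β h n t) {k : ℕ} (hk : 1 ≤ k) :
    annMom B κ β h n (k + 1) ≤ ratioConst B * growth B ^ n * √(k + 1) * annMom B κ β h n k := by
  have hA := one_le_ratioConst hB hB'
  have hg := one_le_growth (B := B)
  have hM := annMom_pos (β := β) (h := h) (n := n) hB.le hκ k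
  have hsq : √(k : ℝ) ≤ √(k + 1) := Real.sqrt_le_sqrt (by linarith)
  -- For `k ≤ 2 ^ n`, log-convexity with `m = k` reduces the ratio to doubling. For larger `k`, the
  -- trivial bound `S ≤ 2 ^ n ≤ √2 ^ n √k` suffices.
  rcases le_or_gt k (2 ^ n) with hkn | hkn
  · rw [← div_le_iff₀ hM]
    have h1 := annMom_ratio_pow_le (β := β) (h := h) (n := n) hB.le hκ k k
    set c := 48 * B * (2 * B / (2 - B)) ^ 2 * (√k * growth B ^ n) with hc
    have hc0 : 0 ≤ c := by
      have : 0 < B := by linarith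
      positivity
    -- The factor `8` bounds `e^(3t)`: `e^(2t)` from the upper bound at order `2k` and `e^t` from
    -- the lower bound at order `k`.
    have h2 : annMom B κ β h n (k + k) ≤ (8 * c) ^ k * annMom B κ β h n k := by
      have h3 := (H (k + k) (by omega)).2
      have h4 := pureMom_two_mul_le hB hB' hk hkn
      have h5 := (H k hk).1
      rw [two_mul] at h4
      have he : Real.exp t ≤ 2 := by
        rw [← Real.le_log_iff_exp_le (by norm_num)]; exact ht
      calc _ ≤ Real.exp (t * (k + k : ℕ)) * (c ^ k * pureMom B n k) := h3.trans (by gcongr)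
        _ = (Real.exp t ^ 3 * c) ^ k * (Real.exp (-t * k) * pureMom B n k) := by
            rw [mul_pow (Real.exp t ^ 3), ← pow_mul, ← Real.exp_nat_mul]
            have : Real.exp (t * (k + k : ℕ)) =
                Real.exp ((3 * k : ℕ) * t) * Real.exp (-t * k) := by
              rw [← Real.exp_add]; congr 1; push_cast; ring
            rw [this]; ring
        _ ≤ (2 ^ 3 * c) ^ k * annMom B κ β h n k := by
            have := pureMom_pos hB.le n k
            gcongr
        _ = _ := by norm_num
    have h3 : (annMom B κ β h n (k + 1) / annMom B κ β h n k) ^ k ≤ (8 * c) ^ k := by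
      refine h1.trans ?_
      rw [div_le_iff₀ hM]; exact h2
    have h4 := le_of_pow_le_pow_left₀ (by omega) (by positivity) h3
    refine h4.trans ?_
    have : 8 * c = ratioConst B * growth B ^ n * √k := by rw [hc, ratioConst]; ring
    rw [this]
    gcongr
  · refine (annMom_succ_le_two_pow hB.le k).trans ?_
    refine mul_le_mul_of_nonneg_right ?_ hM.le
    have h1 : √2 ^ n ≤ √k := by
      refine Real.le_sqrt_of_sq_le ?_
      rw [← pow_mul, mul_comm n 2, pow_mul, Real.sq_sqrt (by norm_num)]
      exact_mod_cast hkn.le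
    have h2 : √2 ^ n ≤ growth B ^ n := pow_le_pow_left₀ (Real.sqrt_nonneg _) sqrt_two_le_growth n
    calc (2 : ℝ) ^ n = √2 ^ n * √2 ^ n := by
          rw [← mul_pow, Real.mul_self_sqrt (by norm_num)]
      _ ≤ growth B ^ n * √(k + 1) := by gcongr; exact h1.trans hsq
      _ = 1 * growth B ^ n * √(k + 1) := by ring
      _ ≤ _ := by gcongr

/-- Ratio of consecutive moments, for a normalized weight. -/
lemma MomComparable.ratio' (hB : 1 < B) (hB' : B < 2) (hκ : 0 ≤ κ) {t : ℝ}
    (ht : t ≤ Real.log 2) (H : MomComparable B κ β h n t) (h1 : treePart B κ β h n = 1) (k : ℕ) :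
    annMom B κ β h n (k + 1) ≤ ratioConst B * growth B ^ n * √(k + 1) * annMom B κ β h n k := by
  rcases Nat.eq_zero_or_pos k with rfl | hk
  · have h2 := (H 1 le_rfl).2
    have he : Real.exp t ≤ 2 := by
      rw [← Real.le_log_iff_exp_le (by norm_num)]; exact ht
    have hb : 0 < B := by linarith
    have hA : 2 ≤ ratioConst B := by
      have h1 : 1 ≤ 2 * B / (2 - B) := by rw [le_div_iff₀ (by linarith)]; linarith
      have h2 : 1 ≤ (2 * B / (2 - B)) ^ 2 := one_le_pow₀ h1
      rw [ratioConst]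
      nlinarith
    have h3 : (2 / B) ^ n ≤ growth B ^ n := pow_le_pow_left₀ (by positivity) two_div_le_growth n
    rw [annMom_order_zero, h1]
    rw [pureMom_one hB.le, Nat.cast_one, mul_one] at h2
    simp only [Nat.cast_zero, zero_add, Real.sqrt_one, mul_one]
    exact h2.trans (mul_le_mul (he.trans hA) h3 (by positivity) (by linarith))
  · exact H.ratio hB hB' hκ ht hk

end

/-! ### One step of the recursion -/

lemma hasSum_pow_div_factorial (x : ℝ) :
    HasSum (fun m : ℕ => x ^ m / m.factorial) (Real.exp x) := by
  rw [Real.exp_eq_exp_ℝ]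
  exact NormedSpace.expSeries_div_hasSum_exp x

section
variable {B κ β h : ℝ} {n : ℕ}

lemma gwExp_add_pow_mul (k m : ℕ) :
    (gwExp B n fun l => gwExp B n fun r => (contactSum l + contactSum r) ^ k *
      (contactSum l * contactSum r) ^ m * (Real.exp (annealedHamiltonian κ β h l) *
        Real.exp (annealedHamiltonian κ β h r))) =
      ∑ j ∈ range (k + 1), k.choose j *
        (annMom B κ β h n (j + m) * annMom B κ β h n (k - j + m)) := by
  simp only [add_pow, sum_mul, gwExp_sum]
  refine sum_congr rfl fun j _ => ?_
  rw [annMom, annMom, ← gwExp_gwExp_mul]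
  simp only [← gwExp_mul_left]
  congr with l; congr with r; ring

lemma annMom_succ {k : ℕ} (hk : 1 ≤ k) : annMom B κ β h (n + 1) k =
    1 / B * gwExp B n fun l => gwExp B n fun r => (contactSum l + contactSum r) ^ k *
      (Real.exp (annealedHamiltonian κ β h l) * Real.exp (annealedHamiltonian κ β h r)) *
        Real.exp (β ^ 2 * κ ^ (n + 1) * (contactSum l * contactSum r)) := by
  rw [annMom, gwExp_succ, contactSum_dead, zero_pow (by omega), zero_mul, mul_zero, zero_add]
  simp only [contactSum_node, annealedHamiltonian_node, Real.exp_add, mul_assoc]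

lemma le_annMom_succ (hB : 1 ≤ B) (hκ : 0 ≤ κ) {k : ℕ} (hk : 1 ≤ k) :
    1 / B * ∑ j ∈ range (k + 1), k.choose j *
      (annMom B κ β h n j * annMom B κ β h n (k - j)) ≤ annMom B κ β h (n + 1) k := by
  have h1 := gwExp_add_pow_mul (B := B) (κ := κ) (β := β) (h := h) (n := n) k 0
  simp only [pow_zero, mul_one, add_zero] at h1
  rw [annMom_succ hk, ← h1]
  refine mul_le_mul_of_nonneg_left ?_ (by have : 0 < B := by linarith
                                          positivity)
  refine gwExp_mono hB fun l => gwExp_mono hB fun r => le_mul_of_one_le_right ?_ ?_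
  all_goals
    have := contactSum_nonneg l
    have := contactSum_nonneg r
  · positivity
  · exact Real.one_le_exp (by positivity)

/-- Iterating the ratio bound produces `√((j+1)⋯(j+m))`. It is enlarged to depend on `k` only, so
that orders `j` and `k - j` receive the same factor and the two square roots multiply to an integer.
-/
lemma annMom_add_le (hB : 1 ≤ B) {L : ℝ} (hL : 0 ≤ L)
    (HR : ∀ k : ℕ, annMom B κ β h n (k + 1) ≤ L * √(k + 1) * annMom B κ β h n k) {j k : ℕ}
    (hj : j ≤ k) (m : ℕ) :
    annMom B κ β h n (j + m) ≤ L ^ m * √((k + 1).ascFactorial m : ℕ) * annMom B κ β h n j := by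
  induction m with
  | zero => simp
  | succ m ih =>
    have h0 := annMom_nonneg (κ := κ) (β := β) (h := h) (n := n) hB j
    calc annMom B κ β h n (j + (m + 1)) ≤ L * √((j + m : ℕ) + 1) * annMom B κ β h n (j + m) :=
          HR (j + m)
      _ ≤ L * √((k + 1 + m : ℕ)) *
          (L ^ m * √((k + 1).ascFactorial m : ℕ) * annMom B κ β h n j) := by
          have : ((j + m : ℕ) : ℝ) + 1 ≤ (k + 1 + m : ℕ) := by
            push_cast
            have : (j : ℝ) ≤ k := by exact_mod_cast hj
            linarith
          have := annMom_nonneg (κ := κ) (β := β) (h := h) (n := n) hB (j + m)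
          gcongr
      _ = _ := by
          rw [Nat.ascFactorial_succ, Nat.cast_mul, Real.sqrt_mul (by positivity), pow_succ]
          ring

/-- Expand the interaction `exp(c S_l S_r)`. In the term of order `m`, raising the moments of both
subtrees by `m` costs `L^(2m) (k+1)⋯(k+m)`, and division by `m!` leaves `C(k+m, k) (c L²)^m`, whose
sum is `(1 - c L²)^(-(k+1))`. A growth of the ratios faster than `√k` would make this series
diverge. -/
lemma annMom_succ_le (hB : 1 ≤ B) (hκ : 0 ≤ κ) {L : ℝ} (hL : 0 ≤ L)
    (HR : ∀ k : ℕ, annMom B κ β h n (k + 1) ≤ L * √(k + 1) * annMom B κ β h n k)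
    (hθ : β ^ 2 * κ ^ (n + 1) * L ^ 2 < 1) {k : ℕ} (hk : 1 ≤ k) :
    annMom B κ β h (n + 1) k ≤ 1 / (1 - β ^ 2 * κ ^ (n + 1) * L ^ 2) ^ (k + 1) *
      (1 / B * ∑ j ∈ range (k + 1), k.choose j *
        (annMom B κ β h n j * annMom B κ β h n (k - j))) := by
  set c := β ^ 2 * κ ^ (n + 1) with hc
  have hc0 : 0 ≤ c := by positivity
  rw [annMom_succ hk, ← mul_assoc _ (1 / B), mul_comm _ (1 / B), mul_assoc]
  refine mul_le_mul_of_nonneg_left ?_ (by have : 0 < B := by linarith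
                                          positivity)
  have h1 : HasSum (fun m : ℕ => gwExp B n fun l => gwExp B n fun r =>
      c ^ m / m.factorial * ((contactSum l + contactSum r) ^ k *
      (contactSum l * contactSum r) ^ m * (Real.exp (annealedHamiltonian κ β h l) *
        Real.exp (annealedHamiltonian κ β h r))))
      (gwExp B n fun l => gwExp B n fun r => (contactSum l + contactSum r) ^ k *
      (Real.exp (annealedHamiltonian κ β h l) * Real.exp (annealedHamiltonian κ β h r)) *
        Real.exp (c * (contactSum l * contactSum r))) := by
    refine hasSum_gwExp fun l => hasSum_gwExp fun r => ?_
    refine ((hasSum_pow_div_factorial (c * (contactSum l * contactSum r))).mul_left _).congr_fun ?_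
    intro m
    rw [mul_pow]; ring
  simp only [gwExp_mul_left, gwExp_add_pow_mul] at h1
  have h2 := (hasSum_choose_mul_geometric_of_norm_lt_one k (r := c * L ^ 2) (by
    rw [Real.norm_eq_abs, abs_of_nonneg (by positivity)]; exact hθ)).mul_right
      (∑ j ∈ range (k + 1), k.choose j * (annMom B κ β h n j * annMom B κ β h n (k - j)))
  refine hasSum_le (fun m => ?_) h1 h2
  rw [mul_sum, mul_sum]
  refine sum_le_sum fun j hj => ?_
  have hj' : j ≤ k := by rw [Finset.mem_range] at hj; omega
  have h3 := annMom_add_le hB hL HR hj' m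
  have h4 := annMom_add_le hB hL HR (Nat.sub_le k j) m
  have h5 := annMom_nonneg (κ := κ) (β := β) (h := h) (n := n) hB (k - j + m)
  have h6 := annMom_nonneg (κ := κ) (β := β) (h := h) (n := n) hB j
  have h7 := mul_le_mul h3 h4 h5 (by positivity)
  calc _ ≤ c ^ m / m.factorial * (k.choose j *
        (L ^ m * √((k + 1).ascFactorial m : ℕ) * annMom B κ β h n j *
          (L ^ m * √((k + 1).ascFactorial m : ℕ) * annMom B κ β h n (k - j)))) := by gcongr
    _ = c ^ m / m.factorial * (L ^ m) ^ 2 *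
        (√((k + 1).ascFactorial m : ℕ) * √((k + 1).ascFactorial m : ℕ)) *
        (k.choose j * (annMom B κ β h n j * annMom B κ β h n (k - j))) := by ring
    _ = _ := by
        rw [Real.mul_self_sqrt (by positivity), Nat.ascFactorial_eq_factorial_mul_choose,
          Nat.cast_mul, ← Nat.choose_symm_add, add_comm k m, mul_pow c]
        have : (m.factorial : ℝ) ≠ 0 := by positivity
        field_simp
        ring

/-- With `e^x ≤ 1 + x e^x` and `x = c S_l S_r ≤ (c/2) (S_l + S_r)²`, the excess mass created by the
interaction is bounded by the second moment at size `n + 1`, interaction included. -/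
lemma treePart_succ_le (hB : 1 ≤ B) (hκ : 0 ≤ κ) (h1 : treePart B κ β h n = 1) :
    treePart B κ β h (n + 1) ≤
      1 + β ^ 2 * κ ^ (n + 1) / 2 * annMom B κ β h (n + 1) 2 := by
  have hb : 0 < B := by linarith
  set c := β ^ 2 * κ ^ (n + 1) with hc
  have hc0 : 0 ≤ c := by positivity
  have h2 : (gwExp B n fun l => gwExp B n fun r =>
      Real.exp (annealedHamiltonian κ β h l) * Real.exp (annealedHamiltonian κ β h r)) = 1 := by
    rw [gwExp_gwExp_mul, ← treePart, h1, one_mul]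
  rw [treePart, gwExp_succ, annealedHamiltonian_dead, Real.exp_zero, mul_one,
    annMom_succ one_le_two]
  have h3 : (gwExp B n fun l => gwExp B n fun r =>
      Real.exp (annealedHamiltonian κ β h (GWTree.node l r))) ≤ 1 + c / 2 *
      gwExp B n fun l => gwExp B n fun r => (contactSum l + contactSum r) ^ 2 *
      (Real.exp (annealedHamiltonian κ β h l) * Real.exp (annealedHamiltonian κ β h r)) *
        Real.exp (c * (contactSum l * contactSum r)) := by
    rw [← h2]
    simp only [← gwExp_mul_left, ← gwExp_add]
    refine gwExp_mono hB fun l => gwExp_mono hB fun r => ?_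
    rw [annealedHamiltonian_node, ← hc, Real.exp_add, Real.exp_add]
    set x := contactSum l
    set y := contactSum r
    have hx : 0 ≤ x := contactSum_nonneg l
    have hy : 0 ≤ y := contactSum_nonneg r
    set w := Real.exp (annealedHamiltonian κ β h l) * Real.exp (annealedHamiltonian κ β h r)
    have hw : 0 ≤ w := by positivity
    have h4 : Real.exp (c * (x * y)) ≤ 1 + c * (x * y) * Real.exp (c * (x * y)) := by
      have h5 := Real.add_one_le_exp (-(c * (x * y)))
      have h6 := mul_le_mul_of_nonneg_right h5 (Real.exp_pos (c * (x * y))).le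
      rw [← Real.exp_add, neg_add_cancel, Real.exp_zero] at h6
      linarith
    have h7 : c * (x * y) ≤ c / 2 * (x + y) ^ 2 := by
      nlinarith [mul_nonneg hc0 (add_nonneg (sq_nonneg x) (sq_nonneg y))]
    calc w * Real.exp (c * (x * y))
        ≤ w * (1 + c / 2 * (x + y) ^ 2 * Real.exp (c * (x * y))) := by
          gcongr
          exact h4.trans (by gcongr)
      _ = _ := by ring
  rw [← hc]
  generalize (gwExp B n fun l => gwExp B n fun r => (contactSum l + contactSum r) ^ 2 * _ * _) = M
    at h3 ⊢
  calc _ ≤ (B - 1) / B + 1 / B * (1 + c / 2 * M) := by gcongr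
    _ = _ := by field_simp; ring

end

lemma MomComparable.mono {B κ β h : ℝ} {n : ℕ} {t t' : ℝ} (hB : 1 ≤ B) (htt : t ≤ t')
    (H : MomComparable B κ β h n t) : MomComparable B κ β h n t' := fun k hk => by
  have := pureMom_pos hB n k
  refine ⟨le_trans ?_ (H k hk).1, (H k hk).2.trans ?_⟩
  · have : -t' * k ≤ -t * k := by
      refine mul_le_mul_of_nonneg_right ?_ k.cast_nonneg
      linarith
    gcongr
  · gcongr

lemma one_div_one_sub_pow_le {θ : ℝ} (h0 : 0 ≤ θ) (h1 : θ ≤ 1 / 2) {k : ℕ} (hk : 1 ≤ k) :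
    1 / (1 - θ) ^ (k + 1) ≤ Real.exp (4 * θ * k) := by
  have h2 : 1 / (1 - θ) ≤ Real.exp (2 * θ) := by
    refine le_trans ?_ (Real.add_one_le_exp (2 * θ))
    rw [div_le_iff₀ (by linarith)]
    nlinarith
  have h3 : (1 : ℝ) ≤ k := by exact_mod_cast hk
  have h5 : 0 < 1 - θ := by linarith
  calc 1 / (1 - θ) ^ (k + 1) = (1 / (1 - θ)) ^ (k + 1) := by rw [div_pow, one_pow]
    _ ≤ Real.exp (2 * θ) ^ (k + 1) := by gcongr
    _ = Real.exp ((k + 1 : ℕ) * (2 * θ)) := by rw [Real.exp_nat_mul]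
    _ ≤ _ := by
      refine Real.exp_le_exp.2 ?_
      push_cast
      nlinarith

/-- Adding the interaction between two blocks. -/
lemma MomComparable.succ {B κ β h : ℝ} {n : ℕ} {t : ℝ} (hB : 1 < B) (hB' : B < 2) (hκ : 0 ≤ κ)
    (ht : t ≤ Real.log 2) (H : MomComparable B κ β h n t) (h1 : treePart B κ β h n = 1) {θ : ℝ}
    (hθ : β ^ 2 * κ ^ (n + 1) * (ratioConst B * growth B ^ n) ^ 2 ≤ θ) (hθ' : θ ≤ 1 / 2) :
    MomComparable B κ β h (n + 1) (t + 4 * θ) := by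
  have hL : 0 ≤ ratioConst B * growth B ^ n := by
    have := one_le_ratioConst hB hB'
    have := one_le_growth (B := B)
    positivity
  set θ₀ := β ^ 2 * κ ^ (n + 1) * (ratioConst B * growth B ^ n) ^ 2 with hθ₀
  have h0 : 0 ≤ θ₀ := by positivity
  have hb : 0 < B := by linarith
  -- Total mass one extends the comparison to order `0`, which occurs in the binomial sums.
  have Hlow (j : ℕ) : Real.exp (-t * j) * pureMom B n j ≤ annMom B κ β h n j := by
    rcases Nat.eq_zero_or_pos j with rfl | hj
    · rw [annMom_order_zero, h1, pureMom_order_zero hB.le]; simp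
    · exact (H j hj).1
  have Hup (j : ℕ) : annMom B κ β h n j ≤ Real.exp (t * j) * pureMom B n j := by
    rcases Nat.eq_zero_or_pos j with rfl | hj
    · rw [annMom_order_zero, h1, pureMom_order_zero hB.le]; simp
    · exact (H j hj).2
  have hp := fun j => pureMom_pos hB.le n j
  have hm := fun j => annMom_nonneg (κ := κ) (β := β) (h := h) (n := n) hB.le j
  -- A factor exponential in the order passes through the binomial recursion, since the orders `j`
  -- and `k - j` add up to `k`.
  have conv (s : ℝ) (k : ℕ) : Real.exp (s * k) * (1 / B * ∑ j ∈ range (k + 1), k.choose j *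
      (pureMom B n j * pureMom B n (k - j))) = 1 / B * ∑ j ∈ range (k + 1), k.choose j *
      ((Real.exp (s * j) * pureMom B n j) * (Real.exp (s * (k - j : ℕ)) * pureMom B n (k - j))) := by
    rw [mul_left_comm, mul_sum]
    congr 1
    refine sum_congr rfl fun j hj => ?_
    have hj' : j ≤ k := by rw [Finset.mem_range] at hj; omega
    have : Real.exp (s * k) = Real.exp (s * j) * Real.exp (s * (k - j : ℕ)) := by
      rw [← Real.exp_add, Nat.cast_sub hj']; congr 1; ring
    rw [this]; ring
  intro k hk
  constructor
  · refine le_trans ?_ (le_annMom_succ hB.le hκ hk)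
    have hp' := pureMom_pos hB.le (n + 1) k
    calc _ ≤ Real.exp (-t * k) * pureMom B (n + 1) k := by
          have : -(t + 4 * θ) * k ≤ -t * k := by
            refine mul_le_mul_of_nonneg_right ?_ k.cast_nonneg
            linarith
          gcongr
      _ ≤ _ := by
          rw [pureMom_succ n hk, conv]
          gcongr with j hj
          · exact mul_nonneg (Real.exp_pos _).le (hp _).le
          · exact hm j
          · exact Hlow j
          · exact Hlow _
  · refine (annMom_succ_le hB.le hκ hL
      (fun k => H.ratio' hB hB' hκ ht h1 k) (by linarith) hk).trans ?_
    rw [← hθ₀]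
    calc _ ≤ Real.exp (4 * θ₀ * k) * (Real.exp (t * k) * pureMom B (n + 1) k) := by
          refine mul_le_mul (one_div_one_sub_pow_le h0 (by linarith) hk) ?_ ?_ (Real.exp_pos _).le
          · rw [pureMom_succ n hk, conv]
            gcongr with j hj
            · exact hm _
            · exact mul_nonneg (Real.exp_pos _).le (hp _).le
            · exact Hup j
            · exact Hup _
          · refine mul_nonneg (by positivity) (sum_nonneg fun j _ => ?_)
            exact mul_nonneg (by positivity) (mul_nonneg (hm _) (hm _))
      _ = Real.exp ((t + 4 * θ₀) * k) * pureMom B (n + 1) k := by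
          rw [← mul_assoc, ← Real.exp_add]; ring_nf
      _ ≤ _ := by
          have := pureMom_pos hB.le (n + 1) k
          gcongr

/-- The critical field at scale `n + 1` is close to the one at scale `n`. -/
lemma field_sub_le {B κ β h h' : ℝ} {n : ℕ} {t : ℝ} (hB : 1 < B) (hB' : B < 2) (hκ : 0 ≤ κ)
    (hκ' : 4 * κ / B ^ 2 ≤ 1) (ht : t ≤ Real.log 2)
    (H : MomComparable B κ β h (n + 1) t) (h1 : treePart B κ β h n = 1)
    (h1' : treePart B κ β h' (n + 1) = 1) (hβ : (8 * B / (2 - B)) ^ 2 * β ^ 2 ≤ 1) :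
    h - h' ≤ 8 * B / (2 - B) * β ^ 2 * (2 * κ / B) ^ (n + 1) := by
  have hb : 0 < B := by linarith
  have hb2 : 0 < 2 - B := by linarith
  set K := 8 * B / (2 - B) with hK
  have hK0 : 0 < K := by positivity
  set c := β ^ 2 * κ ^ (n + 1) with hc
  set s := (2 / B) ^ (n + 1) with hs
  have hs0 : 0 < s := by positivity
  have hc0 : 0 ≤ c := by positivity
  -- With this `d`, the first-order loss `d M₁ ≥ d s / 2` is twice the bound `c K s² / 4` on the
  -- excess mass; smallness of `β` lets the other half pay for `(d²/2) M₂`.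
  set d := K * c * s with hd
  have hd' : K * β ^ 2 * (2 * κ / B) ^ (n + 1) = d := by
    rw [hd, hc, hs, show 2 * κ / B = κ * (2 / B) by ring, mul_pow]; ring
  rw [hd']
  have hd0 : 0 ≤ d := by positivity
  have he : Real.exp t ≤ 2 := by
    rw [← Real.le_log_iff_exp_le (by norm_num)]; exact ht
  have he' : 1 / 2 ≤ Real.exp (-t) := by
    rw [Real.exp_neg, one_div]
    exact inv_anti₀ (Real.exp_pos t) he
  have hM1 : 1 / 2 * s ≤ annMom B κ β h (n + 1) 1 := by
    have := (H 1 le_rfl).1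
    rw [pureMom_one hB.le, Nat.cast_one, mul_one, ← hs] at this
    exact le_trans (by gcongr) this
  have hM2 : annMom B κ β h (n + 1) 2 ≤ K / 2 * s ^ 2 := by
    have h2 := (H 2 one_le_two).2
    have h3 := pureMom_two_le hB hB' (n + 1)
    have h4 : Real.exp (t * (2 : ℕ)) ≤ 4 := by
      rw [mul_comm, Real.exp_nat_mul]
      calc Real.exp t ^ 2 ≤ 2 ^ 2 := by gcongr
        _ = 4 := by norm_num
    have h5 : (4 / B ^ 2) ^ (n + 1) = s ^ 2 := by
      rw [hs, ← pow_mul, mul_comm (n + 1) 2, pow_mul, div_pow 2 B 2]; norm_num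
    rw [h5] at h3
    calc _ ≤ 4 * (B / (2 - B) * s ^ 2) :=
          h2.trans (mul_le_mul h4 h3 (pureMom_pos hB.le _ _).le (by norm_num))
      _ = _ := by rw [hK]; ring
  have hcs : K ^ 2 * (c * s ^ 2) ≤ 1 := by
    have h5 : κ ^ (n + 1) * s ^ 2 ≤ 1 := by
      have : κ ^ (n + 1) * s ^ 2 = (4 * κ / B ^ 2) ^ (n + 1) := by
        rw [hs, ← pow_mul, mul_comm (n + 1) 2, pow_mul, ← mul_pow]; congr 1; ring
      rw [this]
      exact pow_le_one₀ (by positivity) hκ'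
    calc K ^ 2 * (c * s ^ 2) = K ^ 2 * β ^ 2 * (κ ^ (n + 1) * s ^ 2) := by rw [hc]; ring
      _ ≤ 1 * 1 := mul_le_mul hβ h5 (by positivity) (by norm_num)
      _ = 1 := one_mul 1
  have h2 := treePart_succ_le hB.le hκ h1
  have h3 := treePart_sub_le (κ := κ) (β := β) (h := h) (n := n + 1) hB.le hd0
  rw [← hc] at h2
  have h4 : treePart B κ β (h - d) (n + 1) ≤ treePart B κ β h' (n + 1) := by
    rw [h1']
    have h5 := mul_le_mul_of_nonneg_left hM1 hd0
    have h6 := mul_le_mul_of_nonneg_left hM2 (by positivity : 0 ≤ c / 2 + d ^ 2 / 2)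
    have h7 : (c / 2 + d ^ 2 / 2) * (K / 2 * s ^ 2) ≤ d * (1 / 2 * s) := by
      have h8 := mul_le_mul_of_nonneg_left hcs (by positivity : 0 ≤ c * K * s ^ 2 / 4)
      have e1 : (c / 2 + d ^ 2 / 2) * (K / 2 * s ^ 2) =
          c * K * s ^ 2 / 4 + c * K * s ^ 2 / 4 * (K ^ 2 * (c * s ^ 2)) := by rw [hd]; ring
      have e2 : d * (1 / 2 * s) = c * K * s ^ 2 / 4 * 1 + c * K * s ^ 2 / 4 := by rw [hd]; ring
      rw [e1, e2]; linarith
    linarith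
  have h5 := (treePart_strictMono (β := β) (n := n + 1) hB.le hκ).le_iff_le.1 h4
  linarith

/-! ### The critical field -/

/-- The rate at which the effect of the interaction between blocks decays. -/
noncomputable def decay (B κ : ℝ) : ℝ := κ * growth B ^ 2

section
variable {B κ : ℝ}

/-- The two bounds on `κ` match the two possible values of `growth B`: `κ < B² / 4` for `2 / B`, and
`κ < 1/2` for `√2`. -/
lemma decay_lt_one (hB : 1 < B) (hκ : κ < min (B ^ 2 / 4) (1 / 2)) : decay B κ < 1 := by
  have hb : 0 < B := by linarith
  have h1 := hκ.trans_le (min_le_left _ _)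
  have h2 := hκ.trans_le (min_le_right _ _)
  rw [decay, growth]
  rcases max_cases (2 / B) √2 with ⟨h, -⟩ | ⟨h, -⟩ <;> rw [h]
  · rw [div_pow, mul_div_assoc', div_lt_one (by positivity)]; linarith
  · rw [Real.sq_sqrt (by norm_num)]; linarith

lemma decay_nonneg (hκ : 0 ≤ κ) : 0 ≤ decay B κ := mul_nonneg hκ (sq_nonneg _)

variable {β h : ℝ} {n : ℕ}

/-- Lowering the field by a small amount. -/
lemma MomComparable.sub {t : ℝ} (hB : 1 < B) (hB' : B < 2) (hκ : 0 ≤ κ) (ht : t ≤ Real.log 2)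
    (H : MomComparable B κ β h n t) {d D : ℝ} (hd : 0 ≤ d) (hD : 0 ≤ D)
    (hdD : d ≤ D * (2 * κ / B) ^ n) :
    MomComparable B κ β (h - d) n (t + 2 * D * ratioConst B * decay B κ ^ n) := by
  have hb : 0 < B := by linarith
  have hA := one_le_ratioConst hB hB'
  have hg := one_le_growth (B := B)
  have hρ := decay_nonneg (B := B) hκ
  intro k hk
  have hp := pureMom_pos hB.le n k
  have hM := annMom_pos (β := β) (h := h) (n := n) hB.le hκ k
  constructor
  · refine le_trans ?_ (le_annMom_sub hB.le d hd (H.ratio hB hB' hκ ht hk))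
    have hk1 : (1 : ℝ) ≤ k := by exact_mod_cast hk
    have h1 : √((k : ℝ) + 1) ≤ 2 * k := by
      rw [Real.sqrt_le_left (by positivity)]; nlinarith
    have h2 : (2 * κ / B) ^ n * growth B ^ n ≤ decay B κ ^ n := by
      rw [← mul_pow, decay]
      refine pow_le_pow_left₀ (by positivity) ?_ n
      calc 2 * κ / B * growth B = κ * (2 / B * growth B) := by ring
        _ ≤ κ * (growth B * growth B) := by
          have := two_div_le_growth (B := B)
          gcongr
        _ = _ := by ring
    have h3 : d * (ratioConst B * growth B ^ n * √(k + 1)) ≤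
        2 * D * ratioConst B * decay B κ ^ n * k := by
      calc _ ≤ D * (2 * κ / B) ^ n * (ratioConst B * growth B ^ n * (2 * k)) := by gcongr
        _ = 2 * D * ratioConst B * ((2 * κ / B) ^ n * growth B ^ n) * k := by ring
        _ ≤ _ := by gcongr
    calc _ = Real.exp (-(2 * D * ratioConst B * decay B κ ^ n * k)) *
          (Real.exp (-t * k) * pureMom B n k) := by
          rw [← mul_assoc, ← Real.exp_add]; ring_nf
      _ ≤ _ := by
          gcongr
          exact (H k hk).1
  · refine (annMom_mono hB.le (by linarith) k).trans ((H k hk).2.trans ?_)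
    have : 0 ≤ 2 * D * ratioConst B * decay B κ ^ n := by positivity
    gcongr
    linarith

/-- The constant in the bound on the variation of the critical field. -/
noncomputable def fieldConst (B : ℝ) : ℝ := 8 * B / (2 - B)

/-- The constant in the comparison of moments. -/
noncomputable def momConst (B : ℝ) : ℝ :=
  4 * ratioConst B ^ 2 + 2 * fieldConst B * ratioConst B

lemma fieldConst_pos (hB : 1 < B) (hB' : B < 2) : 0 < fieldConst B :=
  div_pos (by linarith) (by linarith)

lemma momConst_pos (hB : 1 < B) (hB' : B < 2) : 0 < momConst B := by
  have := one_le_ratioConst hB hB'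
  have := fieldConst_pos hB hB'
  rw [momConst]; positivity

lemma critField_succ_le (hB : 1 < B) (hκ : 0 ≤ κ) {h' : ℝ} (h1 : treePart B κ β h n = 1)
    (h1' : treePart B κ β h' (n + 1) = 1) : h' ≤ h := by
  have h2 := le_treePart_succ (β := β) hB.le hκ h n
  rw [h1] at h2
  have hb : B ≠ 0 := by linarith
  have e : (B - 1) / B + 1 / B * 1 ^ 2 = 1 := by field_simp; ring
  rw [e, ← h1'] at h2
  exact (treePart_strictMono (β := β) (n := n + 1) hB.le hκ).le_iff_le.1 h2

lemma log_two_gt_half : 1 / 2 < Real.log 2 := by linarith [Real.log_two_gt_d9]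

/-- The interaction costs `4θ` and the renormalization of the field costs `2 * fieldConst B * β² *
ratioConst B * ρ^(n+1)`, where `ρ = decay B κ`; `momConst` collects both. The bound `t ≤ 1 / 8`
keeps the intermediate errors below `log 2`, as the ratio bound requires. -/
lemma MomComparable.step (hB : 1 < B) (hB' : B < 2) (hκ₀ : 0 ≤ κ)
    (hκ : κ < min (B ^ 2 / 4) (1 / 2)) {t h' : ℝ} (ht0 : t ≤ 1 / 8)
    (hβ : fieldConst B ^ 2 * β ^ 2 ≤ 1) (hβ' : 8 * (momConst B * β ^ 2) ≤ 1)
    (H : MomComparable B κ β h n t) (h1 : treePart B κ β h n = 1)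
    (h1' : treePart B κ β h' (n + 1) = 1) :
    h - h' ≤ fieldConst B * β ^ 2 * (2 * κ / B) ^ (n + 1) ∧
      MomComparable B κ β h' (n + 1) (t + momConst B * β ^ 2 * decay B κ ^ n) := by
  have hb : 0 < B := by linarith
  have hA := one_le_ratioConst hB hB'
  have hK := fieldConst_pos hB hB'
  have hρ0 := decay_nonneg (B := B) hκ₀
  have hρ1 := decay_lt_one hB hκ
  have hρn : decay B κ ^ n ≤ 1 := pow_le_one₀ hρ0 hρ1.le
  have hl := log_two_gt_half
  have hAβ : 32 * (ratioConst B ^ 2 * β ^ 2) ≤ 1 := by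
    have : 4 * ratioConst B ^ 2 * β ^ 2 ≤ momConst B * β ^ 2 := by
      rw [momConst]
      have : 0 ≤ 2 * fieldConst B * ratioConst B := by positivity
      gcongr
      linarith
    linarith
  set θ := ratioConst B ^ 2 * β ^ 2 * decay B κ ^ n with hθ
  have hθ0 : 0 ≤ θ := by positivity
  have hθ1 : θ ≤ 1 / 32 := by
    have : θ ≤ ratioConst B ^ 2 * β ^ 2 * 1 := by rw [hθ]; gcongr
    linarith
  have hκ1 : κ ≤ 1 := by
    have := hκ.trans_le (min_le_right _ _)
    linarith
  have h2 : β ^ 2 * κ ^ (n + 1) * (ratioConst B * growth B ^ n) ^ 2 ≤ θ := by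
    have e : β ^ 2 * κ ^ (n + 1) * (ratioConst B * growth B ^ n) ^ 2 = κ * θ := by
      rw [hθ, decay, mul_pow κ, mul_pow, ← pow_mul, ← pow_mul, mul_comm n 2]; ring
    rw [e]
    exact mul_le_of_le_one_left hθ0 hκ1
  have H2 := H.succ hB hB' hκ₀ (by linarith) h1 h2 (by linarith)
  have h3 : h - h' ≤ fieldConst B * β ^ 2 * (2 * κ / B) ^ (n + 1) := by
    refine field_sub_le hB hB' hκ₀ ?_ (by linarith) H2 h1 h1' hβ
    have := hκ.trans_le (min_le_left _ _)
    rw [div_le_one (by positivity)]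
    linarith
  refine ⟨h3, ?_⟩
  have H3 := H2.sub hB hB' hκ₀ (by linarith) (d := h - h')
    (by linarith [critField_succ_le hB hκ₀ h1 h1']) (by positivity) h3
  rw [sub_sub_cancel] at H3
  refine H3.mono hB.le ?_
  have h4 : decay B κ ^ (n + 1) ≤ decay B κ ^ n := pow_le_pow_of_le_one hρ0 hρ1.le (Nat.le_succ n)
  have h5 : 2 * (fieldConst B * β ^ 2) * ratioConst B * decay B κ ^ (n + 1) ≤
    2 * (fieldConst B * β ^ 2) * ratioConst B * decay B κ ^ n := by gcongr
  have e : momConst B * β ^ 2 * decay B κ ^ n =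
    4 * θ + 2 * (fieldConst B * β ^ 2) * ratioConst B * decay B κ ^ n := by
    rw [hθ, momConst]; ring
  linarith

lemma geom_sum_le {r : ℝ} (h0 : 0 ≤ r) (h1 : r < 1) (n : ℕ) :
    ∑ i ∈ range n, r ^ i ≤ 1 / (1 - r) := by
  rw [one_div, ← tsum_geometric_of_lt_one h0 h1]
  exact (summable_geometric_of_lt_one h0 h1).sum_le_tsum _ fun _ _ => by positivity

/-- There is a field at which the annealed moments of all sizes are comparable to the pure ones. -/
lemma exists_critical_field (hB : 1 < B) (hB' : B < 2) (hκ₀ : 0 < κ)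
    (hκ : κ < min (B ^ 2 / 4) (1 / 2)) : ∃ β₀ > 0, ∃ c₁ > 0, ∃ c₂ > 0, ∀ β : ℝ, 0 ≤ β → β ≤ β₀ →
      ∃ h : ℝ, ∀ n, MomComparable B κ β h n (c₁ * β ^ 2) ∧ treePart B κ β h n ≤ 1 ∧
        1 - c₂ * β ^ 2 * (4 * κ / B ^ 2) ^ n ≤ treePart B κ β h n := by
  have hb : 0 < B := by linarith
  have hκ2 := hκ.trans_le (min_le_right _ _)
  have hA := one_le_ratioConst hB hB'
  have hK := fieldConst_pos hB hB'
  have hC := momConst_pos hB hB'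
  have hρ0 := decay_nonneg (B := B) hκ₀.le
  have hρ1 := decay_lt_one hB hκ
  have hl := log_two_gt_half
  set K := fieldConst B
  set C := momConst B
  set A := ratioConst B
  set ρ := decay B κ with hρ
  set r := 2 * κ / B with hr
  have hr0 : 0 < r := by positivity
  have hr1 : r < 1 := by rw [hr, div_lt_one hb]; linarith
  have hρ' : 0 < 1 - ρ := by linarith
  have hr' : 0 < 1 - r := by linarith
  -- The condition `X β² ≤ 1` ensures that the accumulated moment error stays below `1 / 8` and that
  -- `K² β² ≤ 1`.
  set X := 8 * (C / (1 - ρ)) + K ^ 2 with hX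
  have hX0 : 0 < X := by positivity
  set K' := K / (1 - r) with hK'
  have hK'0 : 0 < K' := by positivity
  refine ⟨1 / (1 + X), by positivity, C / (1 - ρ) + 2 * K' * A, by positivity, 2 * K',
    by positivity, fun β hβ0 hββ => ?_⟩
  have hβX : X * β ^ 2 ≤ 1 := by
    have h1 : β ^ 2 ≤ (1 / (1 + X)) ^ 2 := pow_le_pow_left₀ hβ0 hββ 2
    have h2 : X * (1 / (1 + X)) ^ 2 ≤ 1 := by
      rw [div_pow, one_pow, mul_one_div, div_le_one (by positivity)]
      nlinarith
    calc _ ≤ X * (1 / (1 + X)) ^ 2 := by gcongr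
      _ ≤ 1 := h2
  have hβ2 : 0 ≤ β ^ 2 := sq_nonneg β
  have hβ1 : K ^ 2 * β ^ 2 ≤ 1 := by
    have : 0 ≤ 8 * (C / (1 - ρ)) * β ^ 2 := by positivity
    rw [hX] at hβX; linarith
  have hβC : C / (1 - ρ) * β ^ 2 ≤ 1 / 8 := by
    have : 0 ≤ K ^ 2 * β ^ 2 := by positivity
    rw [hX] at hβX; linarith
  have hβC' : 8 * (C * β ^ 2) ≤ 1 := by
    have : C ≤ C / (1 - ρ) := by rw [le_div_iff₀ hρ']; nlinarith
    have := mul_le_mul_of_nonneg_right this hβ2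
    linarith
  have htn (n : ℕ) : C * β ^ 2 * ∑ i ∈ range n, ρ ^ i ≤ C / (1 - ρ) * β ^ 2 := by
    calc _ ≤ C * β ^ 2 * (1 / (1 - ρ)) := by
          have := geom_sum_le hρ0 hρ1 n
          gcongr
      _ = _ := by ring
  choose hc hcb hc1 using exists_treePart_eq_one hB.le hκ₀.le hκ2 β
  have Hc (n : ℕ) : MomComparable B κ β (hc n) n (C * β ^ 2 * ∑ i ∈ range n, ρ ^ i) := by
    induction n with
    | zero =>
      intro k _
      rw [annMom_level_zero, hc1, pureMom_level_zero]
      simp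
    | succ n ih =>
      have := (ih.step hB hB' hκ₀.le hκ ((htn n).trans hβC) hβ1 hβC' (hc1 n) (hc1 (n + 1))).2
      rwa [sum_range_succ, mul_add]
  have hdiff (n : ℕ) : hc n - hc (n + 1) ≤ K * β ^ 2 * r ^ (n + 1) :=
    ((Hc n).step hB hB' hκ₀.le hκ ((htn n).trans hβC) hβ1 hβC' (hc1 n) (hc1 (n + 1))).1
  have hanti : Antitone hc :=
    antitone_nat_of_succ_le fun n => critField_succ_le hB hκ₀.le (hc1 n) (hc1 (n + 1))
  -- Since `K' = K + K' r`, the correction absorbs each decrease of the fields, which are thus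
  -- within `K' β² r^n` of their infimum.
  have hmono : Monotone fun n => hc n - K' * β ^ 2 * r ^ n := by
    refine monotone_nat_of_le_succ fun n => ?_
    have h1 := hdiff n
    have h2 : K * β ^ 2 * r ^ (n + 1) ≤ K * β ^ 2 * r ^ n := by
      have := pow_le_pow_of_le_one hr0.le hr1.le (Nat.le_succ n)
      gcongr
    have h3 : K' * β ^ 2 * r ^ n = K * β ^ 2 * r ^ n + K' * β ^ 2 * r ^ (n + 1) := by
      rw [hK', pow_succ]; field_simp; ring
    linarith
  have hbdd : BddBelow (Set.range hc) := ⟨_, by rintro _ ⟨n, rfl⟩; exact hcb n⟩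
  set hi := ⨅ n, hc n
  have hle (n : ℕ) : hi ≤ hc n := ciInf_le hbdd n
  have hge (n : ℕ) : hc n - hi ≤ K' * β ^ 2 * r ^ n := by
    have : hc n - K' * β ^ 2 * r ^ n ≤ hi := by
      refine le_ciInf fun m => ?_
      rcases le_total n m with hnm | hnm
      · have := hmono hnm
        have h2 : 0 ≤ K' * β ^ 2 * r ^ m := by positivity
        simp only at this
        linarith
      · have := hanti hnm
        have h2 : 0 ≤ K' * β ^ 2 * r ^ n := by positivity
        linarith
    linarith
  refine ⟨hi, fun n => ⟨?_, ?_, ?_⟩⟩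
  · have := (Hc n).sub hB hB' hκ₀.le (by linarith [htn n]) (sub_nonneg.2 (hle n))
      (by positivity) (hge n)
    rw [sub_sub_cancel] at this
    refine this.mono hB.le ?_
    have h1 : 2 * (K' * β ^ 2) * A * ρ ^ n ≤ 2 * (K' * β ^ 2) * A * 1 := by
      have := pow_le_one₀ (n := n) hρ0 hρ1.le
      gcongr
    have h2 := htn n
    have e : (C / (1 - ρ) + 2 * K' * A) * β ^ 2 =
      C / (1 - ρ) * β ^ 2 + 2 * (K' * β ^ 2) * A * 1 := by ring
    rw [e]
    exact add_le_add h2 h1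
  · rw [← hc1 n]; exact treePart_mono hB.le (hle n) n
  · have h1 := le_treePart_sub (κ := κ) (β := β) (h := hc n) (n := n) hB.le (hc n - hi)
    rw [sub_sub_cancel, hc1] at h1
    have h2 := (Hc n 1 le_rfl).2
    rw [pureMom_one hB.le, Nat.cast_one, mul_one] at h2
    have h3 : Real.exp (C * β ^ 2 * ∑ i ∈ range n, ρ ^ i) ≤ 2 := by
      rw [← Real.le_log_iff_exp_le (by norm_num)]; linarith [htn n]
    have h4 : (hc n - hi) * annMom B κ β (hc n) n 1 ≤ K' * β ^ 2 * r ^ n * (2 * (2 / B) ^ n) := by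
      refine mul_le_mul (hge n) (h2.trans (by gcongr)) (annMom_nonneg hB.le 1) (by positivity)
    have e : K' * β ^ 2 * r ^ n * (2 * (2 / B) ^ n) = 2 * K' * β ^ 2 * (4 * κ / B ^ 2) ^ n := by
      have : 4 * κ / B ^ 2 = r * (2 / B) := by rw [hr]; ring
      rw [this, mul_pow]; ring
    linarith

/-! ### Comparison of generating functions -/

lemma hasSum_gen (u : ℝ) : HasSum (fun k : ℕ => u ^ k / k.factorial * annMom B κ β h n k)
    (gwExp B n fun T => Real.exp (u * contactSum T) *
      Real.exp (annealedHamiltonian κ β h T)) := by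
  simp only [annMom, ← gwExp_mul_left]
  refine hasSum_gwExp fun T => ?_
  refine ((hasSum_pow_div_factorial (u * contactSum T)).mul_right
    (Real.exp (annealedHamiltonian κ β h T))).congr_fun fun k => ?_
  rw [mul_pow]; ring

lemma hasSum_pure_gen (u : ℝ) : HasSum (fun k : ℕ => u ^ k / k.factorial * pureMom B n k)
    (gwExp B n fun T => Real.exp (u * contactSum T)) := by
  simp only [pureMom, ← gwExp_mul_left]
  refine hasSum_gwExp fun T => ?_
  refine (hasSum_pow_div_factorial (u * contactSum T)).congr_fun fun k => ?_
  rw [mul_pow]; ring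

lemma MomComparable.gen_le (hB : 1 ≤ B) {t u : ℝ} (hu : 0 ≤ u) (H : MomComparable B κ β h n t)
    (h1 : treePart B κ β h n ≤ 1) :
    (gwExp B n fun T => Real.exp (u * contactSum T) * Real.exp (annealedHamiltonian κ β h T)) ≤
      gwExp B n fun T => Real.exp (Real.exp t * u * contactSum T) := by
  refine hasSum_le (fun k => ?_) (hasSum_gen u) (hasSum_pure_gen (Real.exp t * u))
  rcases Nat.eq_zero_or_pos k with rfl | hk
  · simpa [annMom_order_zero, pureMom_order_zero hB] using h1
  · have := mul_le_mul_of_nonneg_left (H k hk).2 (by positivity : 0 ≤ u ^ k / k.factorial)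
    refine this.trans (le_of_eq ?_)
    rw [mul_pow, ← Real.exp_nat_mul, mul_comm t]; ring

/-- Coefficients of order `k ≥ 1` are compared directly; the order zero coefficient, `Z_n` against
`1`, accounts for the additive term. -/
lemma MomComparable.le_gen (hB : 1 ≤ B) {t u : ℝ} (hu : 0 ≤ u) (H : MomComparable B κ β h n t) :
    treePart B κ β h n - 1 + (gwExp B n fun T => Real.exp (Real.exp (-t) * u * contactSum T)) ≤
      gwExp B n fun T => Real.exp (u * contactSum T) *
        Real.exp (annealedHamiltonian κ β h T) := by
  have h1 := (hasSum_ite_eq (0 : ℕ) (treePart B κ β h n - 1)).add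
    (hasSum_pure_gen (B := B) (n := n) (Real.exp (-t) * u))
  refine hasSum_le (fun k => ?_) h1 (hasSum_gen u)
  rcases Nat.eq_zero_or_pos k with rfl | hk
  · simp [annMom_order_zero, pureMom_order_zero hB]
  · have := mul_le_mul_of_nonneg_left (H k hk).1 (by positivity : 0 ≤ u ^ k / k.factorial)
    rw [if_neg hk.ne', zero_add]
    refine le_trans (le_of_eq ?_) this
    rw [mul_pow, ← Real.exp_nat_mul, mul_comm (-t)]; ring

lemma treePart_add (u : ℝ) : treePart B κ β (h + u) n =
    gwExp B n fun T => Real.exp (u * contactSum T) *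
      Real.exp (annealedHamiltonian κ β h T) := by
  simp only [treePart, annealedHamiltonian_add, Real.exp_add]

lemma freeLim_le_pure (hB : 1 < B) (hκ : 0 ≤ κ) (hκ' : κ < 1 / 2) {t u : ℝ} (hu : 0 ≤ u)
    (H : ∀ n, MomComparable B κ β h n t) (h1 : ∀ n, treePart B κ β h n ≤ 1) :
    freeLim B κ β (h + u) ≤ freeLim B 0 0 (Real.exp t * u) := by
  refine le_of_tendsto_of_tendsto' (tendsto_treeFree hB hκ hκ' _ _)
    (tendsto_treeFree hB le_rfl (by norm_num) _ _) fun n => ?_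
  refine mul_le_mul_of_nonneg_left (Real.log_le_log (treePart_pos hB.le _ _) ?_) (by positivity)
  rw [treePart_add, treePart_pure]
  exact (H n).gen_le hB.le hu (h1 n)

lemma pure_le_freeLim (hB : 1 < B) (hκ : 0 ≤ κ) (hκ' : κ < 1 / 2) {t u : ℝ} (hu : 0 ≤ u)
    (H : ∀ n, MomComparable B κ β h n t) (h1 : ∀ᶠ n in atTop, 1 / 2 ≤ treePart B κ β h n) :
    freeLim B 0 0 (Real.exp (-t) * u) ≤ freeLim B κ β (h + u) := by
  have h2 := (tendsto_treeFree hB le_rfl (by norm_num : (0:ℝ) < 1 / 2) 0 (Real.exp (-t) * u)).sub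
    (tendsto_one_div_two_pow.mul_const (Real.log 2))
  rw [zero_mul, sub_zero] at h2
  refine le_of_tendsto_of_tendsto h2 (tendsto_treeFree hB hκ hκ' β (h + u)) ?_
  filter_upwards [h1] with n hn
  have h3 := (H n).le_gen hB.le hu
  have h4 := one_le_treePart (κ := 0) (β := 0) hB.le le_rfl
    (by positivity : 0 ≤ Real.exp (-t) * u) n
  rw [← treePart_add, ← treePart_pure B 0] at h3
  -- A mass of at least `1/2` loses at most `1/2`, and the pure function is at least `1`, so at
  -- least half of it remains; the resulting `2^(-n) log 2` vanishes in the limit.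
  have h5 : treePart B 0 0 (Real.exp (-t) * u) n / 2 ≤ treePart B κ β (h + u) n := by linarith
  have h6 := Real.log_le_log (by positivity) h5
  rw [Real.log_div (by positivity) (by norm_num)] at h6
  rw [treeFree, treeFree, ← mul_sub]
  gcongr

end

end HierPinning

/-! ### Identification of the critical point and conclusion. -/

theorem theorem3p1 (B κ : ℝ) (hB₁ : 1 < B) (hB₂ : B < 2) (hκ₀ : 0 < κ)
    (hκ : κ < min (B ^ 2 / 4) (1 / 2)) :
    -- the pure free energy is well defined and has critical exponent `ν`
    (∀ h : ℝ, Tendsto (pureFreeEnergyAt B h) atTop (𝓝 (pureFreeEnergy B h))) ∧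
    HasCriticalExponent (pureFreeEnergy B) (Real.log 2 / Real.log (2 / B)) ∧
    ∃ β₀ > 0, ∃ c₁ > 0, ∃ c₂ > 0,
      ∀ (Ω : Type*) [MeasurableSpace Ω] (P : Measure Ω) (ω : ℕ → Ω → ℝ),
        IsHierarchicalDisorder κ ω P →
      ∀ β : ℝ, 0 ≤ β → β ≤ β₀ →
        -- the annealed free energy and the annealed critical point are well defined
        (∀ h : ℝ, Tendsto (annealedFreeEnergyAt P ω B β h) atTop
          (𝓝 (annealedFreeEnergy P ω B β h))) ∧
        (∀ h ≤ annealedCriticalPoint P ω B β, annealedFreeEnergy P ω B β h = 0) ∧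
        (∀ h > annealedCriticalPoint P ω B β, 0 < annealedFreeEnergy P ω B β h) ∧
        -- comparison of the generating functions
        (∀ u ∈ Set.Icc (0 : ℝ) 1, ∀ n : ℕ,
          -c₂ * β ^ 2 * (4 * κ / B ^ 2) ^ n
              + gwExp B n (fun T => Real.exp (Real.exp (-c₁ * β ^ 2) * u * contactSum T))
            ≤ gwExp B n (fun T => Real.exp (u * contactSum T) *
                Real.exp (annealedHamiltonian κ β (annealedCriticalPoint P ω B β) T)) ∧
          gwExp B n (fun T => Real.exp (u * contactSum T) *
                Real.exp (annealedHamiltonian κ β (annealedCriticalPoint P ω B β) T))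
            ≤ gwExp B n (fun T => Real.exp (Real.exp (c₁ * β ^ 2) * u * contactSum T))) ∧
        -- comparison of the free energies
        (∀ u ∈ Set.Icc (0 : ℝ) 1,
          pureFreeEnergy B (Real.exp (-c₁ * β ^ 2) * u)
            ≤ annealedFreeEnergy P ω B β (annealedCriticalPoint P ω B β + u) ∧
          annealedFreeEnergy P ω B β (annealedCriticalPoint P ω B β + u)
            ≤ pureFreeEnergy B (Real.exp (c₁ * β ^ 2) * u)) ∧
        -- the annealed critical exponent is the pure one
        HasCriticalExponent
          (fun u => annealedFreeEnergy P ω B β (annealedCriticalPoint P ω B β + u))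
          (Real.log 2 / Real.log (2 / B)) := by
  have hκ' := hκ.trans_le (min_le_right _ _)
  have hb : 0 < B := by linarith
  set ν := Real.log 2 / Real.log (2 / B) with hν
  have hpure : ∀ h, pureFreeEnergyAt B h = treeFree B 0 0 h := fun h => by
    funext n; rw [pureFreeEnergyAt, treeFree, treePart_pure]
  have hpure' : pureFreeEnergy B = freeLim B 0 0 := by
    funext h; rw [pureFreeEnergy, hpure, freeLim]
  obtain ⟨c, hc, hlow⟩ := exists_le_pure_freeLim hB₁ hB₂
  obtain ⟨c', hc', hup⟩ := exists_pure_freeLim_le hB₁ hB₂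
  rw [← hν] at hlow hup
  obtain ⟨β₀, hβ₀, c₁, hc₁, c₂, hc₂, hcrit⟩ := exists_critical_field hB₁ hB₂ hκ₀ hκ
  refine ⟨fun h => ?_, ?_, β₀, hβ₀, c₁, hc₁, c₂, hc₂, ?_⟩
  · rw [hpure, hpure']
    exact tendsto_treeFree hB₁ le_rfl (by norm_num) 0 h
  · rw [hpure']
    exact ⟨c, hc, c', hc', fun u hu => ⟨hlow u hu, hup u hu.1⟩⟩
  intro Ω _ P ω hω β hβ hββ
  obtain ⟨h, hh⟩ := hcrit β hβ hββ
  have hann : ∀ h, annealedFreeEnergyAt P ω B β h = treeFree B κ β h := fun h => by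
    funext n; rw [annealedFreeEnergyAt, treeFree, hω.annealedPartition_eq hκ₀.le]
  have hann' : annealedFreeEnergy P ω B β = freeLim B κ β := by
    funext h; rw [annealedFreeEnergy, hann, freeLim]
  have hzero := freeLim_eq_zero_iff hB₁ hκ₀.le hκ' β
  have hcp : annealedCriticalPoint P ω B β = sSup {h : ℝ | freeLim B κ β h = 0} := by
    rw [annealedCriticalPoint, hann']
  rw [← hcp] at hzero
  have hr0 : 0 ≤ 4 * κ / B ^ 2 := by positivity
  have hr1 : 4 * κ / B ^ 2 < 1 := by
    rw [div_lt_one (by positivity)]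
    have := hκ.trans_le (min_le_left _ _)
    linarith
  have hhalf : ∀ᶠ n in atTop, 1 / 2 ≤ treePart B κ β h n := by
    have h1 := (tendsto_pow_atTop_nhds_zero_of_lt_one hr0 hr1).const_mul (c₂ * β ^ 2)
    rw [mul_zero] at h1
    filter_upwards [h1.eventually_lt_const (by norm_num : (0 : ℝ) < 1 / 2)] with n hn
    linarith [(hh n).2.2]
  have hge (u : ℝ) (hu : 0 ≤ u) :
      freeLim B 0 0 (Real.exp (-(c₁ * β ^ 2)) * u) ≤ freeLim B κ β (h + u) :=
    pure_le_freeLim hB₁ hκ₀.le hκ' hu (fun n => (hh n).1) hhalf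
  have hle (u : ℝ) (hu : 0 ≤ u) :
      freeLim B κ β (h + u) ≤ freeLim B 0 0 (Real.exp (c₁ * β ^ 2) * u) :=
    freeLim_le_pure hB₁ hκ₀.le hκ' hu (fun n => (hh n).1) fun n => (hh n).2.1
  have hexp : Real.exp (-(c₁ * β ^ 2)) ≤ 1 := Real.exp_le_one_iff.2 (by
    have := sq_nonneg β
    nlinarith)
  have hmem {u : ℝ} (hu : u ∈ Set.Icc (0 : ℝ) 1) :
      Real.exp (-(c₁ * β ^ 2)) * u ∈ Set.Icc (0 : ℝ) 1 :=
    ⟨mul_nonneg (Real.exp_pos _).le hu.1, mul_le_one₀ hexp hu.1 hu.2⟩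
  have hcrit_eq : annealedCriticalPoint P ω B β = h := by
    refine le_antisymm ?_ ((hzero h).1
      (freeLim_eq_zero_of_le_one hB₁ hκ₀.le hκ' fun n => (hh n).2.1))
    by_contra! hlt
    -- Truncation at `1` keeps `u` in the range of the pure lower bound; if `h` were below the
    -- critical point, the free energy at `h + u` would be both zero and positive.
    set u := min (annealedCriticalPoint P ω B β - h) 1 with hu
    have hu0 : 0 < u := lt_min (by linarith) one_pos
    have h1 := (hzero (h + u)).2 (by linarith [min_le_left (annealedCriticalPoint P ω B β - h) 1])
    have h2 := hge u hu0.le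
    have h3 := hlow _ (hmem ⟨hu0.le, min_le_right _ _⟩)
    have h4 : 0 < c * (Real.exp (-(c₁ * β ^ 2)) * u) ^ ν := by positivity
    linarith
  rw [hann', hpure', hcrit_eq]
  simp only [neg_mul]
  rw [hcrit_eq] at hzero
  refine ⟨fun h' => ?_, fun h' hle' => (hzero h').2 hle', fun h' hlt => ?_, fun u hu n => ⟨?_, ?_⟩,
    fun u hu => ⟨hge u hu.1, hle u hu.1⟩, ?_⟩
  · rw [hann]
    exact tendsto_treeFree hB₁ hκ₀.le hκ' β h'
  · refine lt_of_le_of_ne (freeLim_nonneg hB₁ hκ₀.le hκ' β h') fun h0 => ?_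
    exact absurd ((hzero h').1 h0.symm) (not_le.2 hlt)
  · have h1 := (hh n).1.le_gen hB₁.le hu.1
    linarith [(hh n).2.2]
  · exact (hh n).1.gen_le hB₁.le hu.1 (hh n).2.1
  · refine ⟨c * Real.exp (-(c₁ * β ^ 2)) ^ ν, by positivity,
      c' * Real.exp (c₁ * β ^ 2) ^ ν, by positivity, fun u hu => ⟨?_, ?_⟩⟩
    · refine le_trans (le_of_eq ?_) ((hlow _ (hmem hu)).trans (hge u hu.1))
      rw [Real.mul_rpow (Real.exp_pos _).le hu.1]; ring
    · refine (hle u hu.1).trans ((hup _ (mul_nonneg (Real.exp_pos _).le hu.1)).trans (le_of_eq ?_))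
      rw [Real.mul_rpow (Real.exp_pos _).le hu.1]; ring
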